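/- \textbf{2D Demand Bin Packing.} An instance consists of natural numbers $T$ (number of time slots of a bin) and $C$ (capacity of each time slot) and of $n$ tasks, where task $i$ has height $h_i\in\mathbb N$ and width $w_i\in\mathbb N$ with $h_i\le C$ and $w_i\le T$. A feasible allocation of a set $S$ of tasks into a bin assigns to each $i\in S$ a starting slot $\mathcal A(i)\ge 1$ with $\mathcal A(i)+w_i-1\le T$, so that task $i$ puts load $h_i$ on each of the slots $\mathcal A(i),\dots,\mathcal A(i)+w_i-1$, such that the total load on every slot $t\in\{1,\dots,T\}$ is at most $C$. A solution with $m$ bins distributes all tasks over $m$ bins together with a feasible allocation for each bin; $OPT$ is the smallest $m$ for which a solution with $m$ bins exists. \textbf{Theorem.} There is a $2$-approximation for 2D Demand Bin Packing for square tasks and square bins: there is an algorithm that, on every instance with $T=C$ and $h_i=w_i$ for all $i$, computes a solution with at most $2\cdot OPT$ bins, in time polynomial in the length of the binary encoding of the instance. -/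

import Mathlib

/-! ### A random access machine with logarithmic cost -/

namespace RAM

/-- Length of a number in binary together with one delimiter. -/
def len (x : ℕ) : ℕ := Nat.size x + 1

/-- Memory: number registers `reg x` and random access arrays `arr a` with cells `arr a i`.
A program mentions finitely many register names `x` and array names `a`;
cell indices `i` are computed at run time. -/
@[ext]
structure State where
  reg : ℕ → ℕ
  arr : ℕ → ℕ → ℕ

/-- Arithmetic expressions. Subtraction is truncated at `0`. There is no multiplication. -/
inductive Expr where
  | const (v : ℕ)
  | var (x : ℕ)
  | get (a : ℕ) (i : Expr)
  | add (e₁ e₂ : Expr)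
  | sub (e₁ e₂ : Expr)

/-- Value of an expression. -/
def Expr.val (s : State) : Expr → ℕ
  | .const v => v
  | .var x => s.reg x
  | .get a i => s.arr a (i.val s)
  | .add e₁ e₂ => e₁.val s + e₂.val s
  | .sub e₁ e₂ => e₁.val s - e₂.val s

/-- Evaluating an expression costs the total length of all the numbers that are handled: constants,
register and cell contents, cell indices, and results of operations. -/
def Expr.cost (s : State) : Expr → ℕ
  | .const v => len v
  | .var x => len (s.reg x)
  | .get a i => i.cost s + len (s.arr a (i.val s))
  | .add e₁ e₂ => e₁.cost s + e₂.cost s + len (e₁.val s + e₂.val s)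
  | .sub e₁ e₂ => e₁.cost s + e₂.cost s + len (e₁.val s - e₂.val s)

/-- Programs. Conditions of `ite` and `loop` hold when the expression is nonzero. -/
inductive Prog where
  | skip
  | assign (x : ℕ) (e : Expr)
  | store (a : ℕ) (i e : Expr)
  | seq (p q : Prog)
  | ite (e : Expr) (p q : Prog)
  | loop (e : Expr) (p : Prog)

/-- Write `v` into register `x`. -/
def State.setReg (s : State) (x v : ℕ) : State :=
  { s with reg := Function.update s.reg x v }

/-- Write `v` into cell `i` of array `a`. -/
def State.setArr (s : State) (a i v : ℕ) : State :=
  { s with arr := Function.update s.arr a (Function.update (s.arr a) i v) }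

/-- `Exec p s s' t`: started in `s`, program `p` halts in `s'` after time exactly `t`. -/
inductive Exec : Prog → State → State → ℕ → Prop
  | skip (s : State) : Exec .skip s s 1
  | assign (s : State) (x : ℕ) (e : Expr) :
      Exec (.assign x e) s (s.setReg x (e.val s)) (e.cost s + 1)
  | store (s : State) (a : ℕ) (i e : Expr) :
      Exec (.store a i e) s (s.setArr a (i.val s) (e.val s)) (i.cost s + e.cost s + 1)
  | seq {p q : Prog} {s s₁ s₂ : State} {t₁ t₂ : ℕ} :
      Exec p s s₁ t₁ → Exec q s₁ s₂ t₂ → Exec (.seq p q) s s₂ (t₁ + t₂)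
  | ite_true {e : Expr} {p q : Prog} {s s' : State} {t : ℕ} :
      e.val s ≠ 0 → Exec p s s' t → Exec (.ite e p q) s s' (e.cost s + 1 + t)
  | ite_false {e : Expr} {p q : Prog} {s s' : State} {t : ℕ} :
      e.val s = 0 → Exec q s s' t → Exec (.ite e p q) s s' (e.cost s + 1 + t)
  | loop_done {e : Expr} {p : Prog} {s : State} :
      e.val s = 0 → Exec (.loop e p) s s (e.cost s + 1)
  | loop_step {e : Expr} {p : Prog} {s s₁ s₂ : State} {t₁ t₂ : ℕ} :
      e.val s ≠ 0 → Exec p s s₁ t₁ → Exec (.loop e p) s₁ s₂ t₂ →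
        Exec (.loop e p) s s₂ (e.cost s + 1 + t₁ + t₂)

end RAM

/-! ### 2D Demand Bin Packing -/

/-- Bins have time slots `1, …, T`, each of capacity `C`; task `i` has height `h i` and
width `w i`. -/
structure DemandInstance where
  T : ℕ
  C : ℕ
  n : ℕ
  h : Fin n → ℕ
  w : Fin n → ℕ

namespace DemandInstance

/-- Every single task fits into an empty bin. -/
def Fits (I : DemandInstance) : Prop := ∀ i, I.h i ≤ I.C ∧ I.w i ≤ I.T

/-- Square tasks and square bins. -/
def IsSquareSquare (I : DemandInstance) : Prop := I.T = I.C ∧ ∀ i, I.h i = I.w i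

/-- Total load in time slot `t` when the tasks of `S` are started at the slots given by `A`; task
`i` puts load `h i` on the slots `A i, …, A i + w i - 1`. -/
def load (I : DemandInstance) (S : Finset (Fin I.n)) (A : Fin I.n → ℕ) (t : ℕ) : ℕ :=
  ∑ i ∈ S with A i ≤ t ∧ t < A i + I.w i, I.h i

/-- `A` is a feasible allocation of the tasks of `S` into one bin. -/
def FeasibleAllocation (I : DemandInstance) (S : Finset (Fin I.n)) (A : Fin I.n → ℕ) : Prop :=
  (∀ i ∈ S, 1 ≤ A i ∧ A i + I.w i ≤ I.T + 1) ∧ ∀ t ∈ Finset.Icc 1 I.T, I.load S A t ≤ I.C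

/-- A solution with `m` bins `0, …, m - 1`: task `i` goes to bin `b i` and starts there in slot
`A i`. -/
def IsSolution (I : DemandInstance) (m : ℕ) (b A : Fin I.n → ℕ) : Prop :=
  (∀ i, b i < m) ∧ ∀ j < m, I.FeasibleAllocation (Finset.univ.filter fun i => b i = j) A

/-- Minimum number of bins of a solution. -/
noncomputable def OPT (I : DemandInstance) : ℕ := sInf {m | ∃ b A, I.IsSolution m b A}

/-- If every task fits into an empty bin, the set whose infimum defines `OPT` is nonempty. -/
theorem exists_solution (I : DemandInstance) (hI : I.Fits) :
    ∃ m b A, I.IsSolution m b A := by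
  refine ⟨I.n, fun i => i, fun _ => 1, fun i => i.2, fun j hj => ⟨fun i _ => ?_, fun t _ => ?_⟩⟩
  · have := (hI i).2
    exact ⟨le_rfl, by dsimp only; omega⟩
  · have hs : (Finset.univ.filter fun i : Fin I.n => (i : ℕ) = j) = {⟨j, hj⟩} := by
      ext i
      simp [Fin.ext_iff]
    unfold load
    rw [hs]
    refine (Finset.sum_le_sum_of_subset (Finset.filter_subset _ _)).trans ?_
    simpa using (hI ⟨j, hj⟩).1

/-- Length of the binary encoding of the instance. -/
def size (I : DemandInstance) : ℕ :=
  RAM.len I.T + RAM.len I.C + ∑ i, (RAM.len (I.h i) + RAM.len (I.w i))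

/-- Input convention: `n`, `T`, `C` stand in registers `0`, `1`, `2`, the heights in cells
`0, …, n - 1` of array `0`, the widths in those of array `1`; everything else is `0`. -/
def input (I : DemandInstance) : RAM.State where
  reg x := if x = 0 then I.n else if x = 1 then I.T else if x = 2 then I.C else 0
  arr a i :=
    if hi : i < I.n then if a = 0 then I.h ⟨i, hi⟩ else if a = 1 then I.w ⟨i, hi⟩ else 0 else 0

end DemandInstance

/-- `p` is a polynomial-time `k`-approximation for 2D Demand Bin Packing restricted to the
instances in the class `P`. Output convention: the number of bins stands in register `0`, the bin
of task `i` in cell `i` of array `2`, and its start slot in cell `i` of array `3`. -/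
def IsPolyTimeApproximation (k : ℕ) (P : DemandInstance → Prop) (p : RAM.Prog) : Prop :=
  ∃ q : Polynomial ℕ, ∀ I : DemandInstance, I.Fits → P I →
    ∃ (s : RAM.State) (t : ℕ), RAM.Exec p I.input s t ∧ t ≤ q.eval I.size ∧
      I.IsSolution (s.reg 0) (fun i => s.arr 2 i) (fun i => s.arr 3 i) ∧ s.reg 0 ≤ k * I.OPT

/-! ### Lower bounds for the optimum of square instances -/

namespace DemandInstance

variable {I : DemandInstance}

/-! Tasks are packed by decreasing size; call a size large above T/2, medium in (T/3, T/2] and small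
otherwise. Every large task opens a bin of its own. The other tasks are put into columns: the tasks
of a column share a starting slot, its first task fixes its width, and in a bin with a large task
that task begins the first column. Bins with large tasks are filled starting from the smallest large
task. A task that fits neither the current one nor the next one goes to a bin without a large task.

Suppose that a bin with first task z rejects a task x with z + x ≤ T. It has at least two columns
and every column has at least two tasks, so it holds four tasks (`ColumnBin.four_le`). Its area is
at least 4/9 of the bin if z is large or medium, and 5/9 if z is small (`ColumnBin.area_large`,
`area_medium`, `area_small`).

Let L bins have a large task, and let r bins have none, K of them beginning with a medium task. When
a medium task fits nowhere, every bin either has four tasks larger than T/3 or has a large task that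
excludes all tasks of the current size. `IsSolution.card_add_le` gives both kinds weight 4, so the
optimum needs yet another bin. Hence L + K ≤ OPT.

When a small task fits nowhere, compare the r - K bins that begin with a small task to the other L +
K. If they are fewer, L + r + 1 ≤ 2(L + K) ≤ 2 OPT. Otherwise the fractions 5/9 and 4/9 average to
at least 1/2, and the new task makes the area bound strict: L + r < 2 OPT (`Config.Inv.L_add_r_lt`).

For the running time, the program makes O(n²) elementary steps. Without multiplication each step
adds only boundedly many bits to the numbers in memory, so the logarithmic cost is polynomial too
(`RAM.Steps.exec`). -/

theorem exists_isSolution_OPT (hI : I.Fits) : ∃ b A, I.IsSolution I.OPT b A :=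
  Nat.sInf_mem (s := {m | ∃ b A, I.IsSolution m b A}) (I.exists_solution hI)

/-- Items of a bin that cover a common slot have total height at most the capacity. -/
theorem IsSolution.sum_le {m : ℕ} {b A : Fin I.n → ℕ} (h : I.IsSolution m b A) {j t : ℕ}
    (S : Finset (Fin I.n)) (hS : ∀ i ∈ S, b i = j ∧ A i ≤ t ∧ t < A i + I.w i) :
    ∑ i ∈ S, I.h i ≤ I.C := by
  rcases S.eq_empty_or_nonempty with rfl | ⟨i, hi⟩
  · simp
  have hij := hS i hi
  have hj : j < m := hij.1 ▸ h.1 i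
  obtain ⟨h1, h2⟩ := h.2 j hj
  have hA := h1 i (by simp [hij.1])
  refine le_trans ?_ (h2 t (by simp; omega))
  refine Finset.sum_le_sum_of_subset fun k hk => ?_
  simpa using hS k hk

theorem IsSolution.start {m : ℕ} {b A : Fin I.n → ℕ} (h : I.IsSolution m b A) (i : Fin I.n) :
    1 ≤ A i ∧ A i + I.w i ≤ I.T + 1 :=
  (h.2 (b i) (h.1 i)).1 i (by simp)

/-- Two items whose sizes exceed the side of the bin cannot share a bin. -/
theorem IsSolution.add_le (hQ : I.IsSquareSquare) {m : ℕ} {b A : Fin I.n → ℕ}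
    (h : I.IsSolution m b A) {i k : Fin I.n} (hik : i ≠ k) (hb : b i = b k) :
    I.h i + I.h k ≤ I.T := by
  by_contra! hlt
  have hi := h.start i
  have hk := h.start k
  rw [← hQ.2] at hi hk
  -- Two intervals inside `[1, T]` of total length more than T intersect, and the later start is a
  -- common slot.
  have := h.sum_le (j := b k) (t := max (A i) (A k)) {i, k} (by
    simp only [Finset.mem_insert, Finset.mem_singleton, forall_eq_or_imp, forall_eq, ← hQ.2]
    rcases le_total (A i) (A k) with hA | hA
    · rw [max_eq_right hA]
      exact ⟨⟨hb, hA, by omega⟩, trivial, le_rfl, by omega⟩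
    · rw [max_eq_left hA]
      exact ⟨⟨hb, le_rfl, by omega⟩, trivial, hA, by omega⟩)
  rw [Finset.sum_pair hik, ← hQ.1] at this
  omega

/-- At most two items larger than a third of the bin cover a common slot. -/
theorem IsSolution.card_le_two (hQ : I.IsSquareSquare) {m : ℕ} {b A : Fin I.n → ℕ}
    (h : I.IsSolution m b A) {j t : ℕ} (S : Finset (Fin I.n))
    (hS : ∀ i ∈ S, b i = j ∧ A i ≤ t ∧ t < A i + I.w i) (h3 : ∀ i ∈ S, I.T < 3 * I.h i) :
    S.card ≤ 2 := by
  have h1 := h.sum_le S hS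
  have h2 : S.card * (I.T + 1) ≤ ∑ i ∈ S, 3 * I.h i := by
    rw [← smul_eq_mul]
    exact Finset.card_nsmul_le_sum _ _ _ fun i hi => h3 i hi
  rw [← Finset.mul_sum] at h2
  rw [← hQ.1] at h1
  by_contra! hc
  have : 3 * (I.T + 1) ≤ S.card * (I.T + 1) := Nat.mul_le_mul_right _ hc
  omega

/-- A bin contains at most four items larger than a third of the bin. -/
theorem IsSolution.card_le_four (hQ : I.IsSquareSquare) {m : ℕ} {b A : Fin I.n → ℕ}
    (h : I.IsSolution m b A) {j : ℕ} (S : Finset (Fin I.n))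
    (hS : ∀ i ∈ S, b i = j) (h3 : ∀ i ∈ S, I.T < 3 * I.h i) : S.card ≤ 4 := by
  classical
  -- An interval longer than T/3 must contain slot `x` or its mirror image `T + 1 - x`; each of
  -- these slots meets at most two items.
  obtain ⟨x, hx⟩ : ∃ x, x = I.T / 3 + 1 := ⟨_, rfl⟩
  have hstart : ∀ i, 1 ≤ A i ∧ A i + I.h i ≤ I.T + 1 := fun i => by
    rw [hQ.2]; exact h.start i
  have h1 : (S.filter fun i => A i ≤ x).card ≤ 2 := by
    refine h.card_le_two hQ (j := j) (t := x) _ (fun i hi => ?_) fun i hi => ?_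
    · rw [Finset.mem_filter] at hi
      have := h3 i hi.1
      have := hstart i
      exact ⟨hS i hi.1, hi.2, by rw [← hQ.2]; omega⟩
    · exact h3 i (Finset.mem_filter.1 hi).1
  have h2 : (S.filter fun i => ¬ A i ≤ x).card ≤ 2 := by
    refine h.card_le_two hQ (j := j) (t := I.T + 1 - x) _ (fun i hi => ?_) fun i hi => ?_
    · rw [Finset.mem_filter] at hi
      have := h3 i hi.1
      have := hstart i
      exact ⟨hS i hi.1, by omega, by rw [← hQ.2]; omega⟩
    · exact h3 i (Finset.mem_filter.1 hi).1
  have := Finset.card_filter_add_card_filter_not (s := S) (fun i => A i ≤ x)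
  omega

/-- The number of large items is at most the number of bins. -/
theorem IsSolution.card_large_le (hQ : I.IsSquareSquare) {m : ℕ} {b A : Fin I.n → ℕ}
    (h : I.IsSolution m b A) (S : Finset (Fin I.n)) (hS : ∀ i ∈ S, I.T < 2 * I.h i) :
    S.card ≤ m := by
  have : S.card ≤ (Finset.range m).card := by
    refine Finset.card_le_card_of_injOn b (fun i _ => by simpa using h.1 i) ?_
    intro i hi k hk hb
    by_contra hne
    have := h.add_le hQ hne hb
    have := hS i hi
    have := hS k hk
    omega
  simpa using this

/-- Let `x` be larger than a third of the bin. A bin with an item of size more than `T - x` has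
no other item of size at least `x`; any other bin has at most four. -/
theorem IsSolution.card_add_le (hQ : I.IsSquareSquare) {m : ℕ} {b A : Fin I.n → ℕ}
    (h : I.IsSolution m b A) {x : ℕ} (hx : I.T < 3 * x) (S U : Finset (Fin I.n))
    (hS : ∀ i ∈ S, x ≤ I.h i) (hUS : U ⊆ S) (hU : ∀ i ∈ U, I.T < I.h i + x) :
    S.card + 3 * U.card ≤ 4 * m := by
  classical
  have hcard : ∀ V : Finset (Fin I.n),
      V.card = ∑ j ∈ Finset.range m, (V.filter fun i => b i = j).card := fun V =>
    Finset.card_eq_sum_card_fiberwise fun i _ => by simpa using h.1 i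
  rw [hcard S, hcard U, Finset.mul_sum, ← Finset.sum_add_distrib]
  refine (Finset.sum_le_card_nsmul _ _ 4 fun j _ => ?_).trans (by simp [mul_comm])
  -- Each bin has weight at most 4: four items of `S` and none of `U`, or a single item counted once
  -- for `S` and three times for `U`.
  rcases (U.filter fun i => b i = j).eq_empty_or_nonempty with h0 | ⟨u, hu⟩
  · rw [h0]
    have := h.card_le_four hQ (j := j) (S.filter fun i => b i = j)
      (fun i hi => (Finset.mem_filter.1 hi).2)
      (fun i hi => by have := hS i (Finset.mem_filter.1 hi).1; omega)
    simpa using this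
  · rw [Finset.mem_filter] at hu
    have h1 : (S.filter fun i => b i = j) ⊆ {u} := by
      intro i hi
      rw [Finset.mem_filter] at hi
      rw [Finset.mem_singleton]
      by_contra hne
      have := h.add_le hQ hne (hi.2.trans hu.2.symm)
      have := hS i hi.1
      have := hU u hu.1
      omega
    have h2 := Finset.card_le_card h1
    have h3 := Finset.card_le_card
      ((Finset.filter_subset_filter (fun i => b i = j) hUS).trans h1)
    simp only [Finset.card_singleton] at h2 h3
    omega

/-- The total area is at most the area of the bins. -/
theorem IsSolution.area_le (hQ : I.IsSquareSquare) {m : ℕ} {b A : Fin I.n → ℕ}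
    (h : I.IsSolution m b A) : ∑ i, I.h i ^ 2 ≤ m * I.T ^ 2 := by
  classical
  -- The square is spread over the `h i` slots it occupies, so areas can be summed slot by slot and
  -- compared with the capacity.
  have hcell : ∀ i, I.h i ^ 2 =
      ∑ t ∈ Finset.Icc 1 I.T, if A i ≤ t ∧ t < A i + I.w i then I.h i else 0 := fun i => by
    have := h.start i
    rw [← Finset.sum_filter, Finset.sum_const, smul_eq_mul, sq]
    congr 1
    have : (Finset.Icc 1 I.T).filter (fun t => A i ≤ t ∧ t < A i + I.w i) =
        Finset.Ico (A i) (A i + I.w i) := by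
      ext t
      simp only [Finset.mem_filter, Finset.mem_Icc, Finset.mem_Ico]
      omega
    rw [this, Nat.card_Ico, hQ.2]
    omega
  rw [← Finset.sum_fiberwise_of_maps_to (s := Finset.univ) (t := Finset.range m) (g := b)
    (fun i _ => by simpa using h.1 i)]
  refine (Finset.sum_le_card_nsmul _ _ (I.T ^ 2) fun j hj => ?_).trans (by simp)
  rw [Finset.sum_congr rfl fun i _ => hcell i, Finset.sum_comm]
  refine (Finset.sum_le_card_nsmul _ _ I.T fun t ht => ?_).trans (by simp [sq])
  rw [← Finset.sum_filter]
  have := (h.2 j (by simpa using hj)).2 t ht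
  rw [← hQ.1] at this
  exact this

end DemandInstance

/-! ### Packing a bin by columns -/

/-- A bin of side `T` that was packed by columns with items of decreasing size.
The current column starts at slot `st` and has load `l`, the columns occupy the slots up to `e`,
and `x` bounds the size of the items to come. The first item has size `z`, there are `k` columns,
`c` items in the current column, `m` items altogether, of total area `a`; `f` is the load. -/
structure ColumnBin (T x : ℕ) (f : ℕ → ℕ) (st e l z k c m a : ℕ) : Prop where
  st_pos : 1 ≤ st
  le_width : x + st ≤ e + 1
  width_le : e + 1 ≤ z + st
  z_le : z ≤ e
  e_le : e ≤ T
  l_le : l ≤ T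
  k_pos : 1 ≤ k
  l_le_mul : l ≤ c * z
  e_le_mul : e ≤ k * z
  count : 2 * k + c ≤ m + 2
  width : z + (k - 1) * x ≤ e
  -- With column widths `w₁ = z, …, w_k`, a closed column j has area at least `w_j² + (T - w_j -
  -- w_{j+1}) w_{j+1}`, since it rejected the first item of the next one; the current column has at
  -- least `w_k² + (l - w_k) y`. The squares telescope. The products satisfy `∑ (z - w_{j-1}) w_j ≥
  -- y ((k - 1) z - e + w_k)`, which yields the bound.
  area : ∀ y : ℕ, y ≤ x →
    (z : ℤ) ^ 2 + (T - z) * (e - z) + y * ((k - 1) * z - e + l) ≤ a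
  load_le : ∀ t, f t ≤ T
  load_le_l : ∀ t, st ≤ t → f t ≤ l
  load_eq_zero : ∀ t, e < t → f t = 0

namespace ColumnBin

variable {T x : ℕ} {f : ℕ → ℕ} {st e l z k c m a : ℕ}

theorem mono (h : ColumnBin T x f st e l z k c m a) {y : ℕ} (hy : y ≤ x) :
    ColumnBin T y f st e l z k c m a where
  __ := h
  le_width := by have := h.le_width; omega
  width := (Nat.add_le_add_left (Nat.mul_le_mul_left _ hy) _).trans h.width
  area u hu := h.area u (hu.trans hy)

/-- A bin with a single item. -/
theorem single (hx : x ≤ T) (hf : ∀ t, f t ≤ x) (hf0 : ∀ t, x < t → f t = 0) :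
    ColumnBin T x f 1 x x x 1 1 1 (x ^ 2) where
  st_pos := le_rfl
  le_width := le_rfl
  width_le := le_rfl
  z_le := le_rfl
  e_le := hx
  l_le := hx
  k_pos := le_rfl
  l_le_mul := by simp
  e_le_mul := by simp
  count := le_rfl
  width := by simp
  area y hy := by push_cast; ring_nf; rfl
  load_le t := (hf t).trans hx
  load_le_l t _ := hf t
  load_eq_zero := hf0

/-- Serves bins whose first item alone has enough area. -/
theorem sq_le_area (h : ColumnBin T x f st e l z k c m a) : z ^ 2 ≤ a := by
  have := h.area 0 (Nat.zero_le _)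
  have h1 : (z : ℤ) ≤ e := by exact_mod_cast h.z_le
  have h2 : (e : ℤ) ≤ T := by exact_mod_cast h.e_le
  rw [Nat.cast_zero, zero_mul] at this
  zify
  linarith [mul_nonneg (sub_nonneg.2 (h1.trans h2)) (sub_nonneg.2 h1)]

/-- Put another item on the current column. -/
theorem stack (h : ColumnBin T x f st e l z k c m a) {y : ℕ} (hy : y ≤ x) (hl : l + y ≤ T)
    {g : ℕ → ℕ} (hg : ∀ t, g t = f t + if st ≤ t ∧ t < st + y then y else 0) :
    ColumnBin T y g st e (l + y) z k (c + 1) (m + 1) (a + y ^ 2) where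
  st_pos := h.st_pos
  le_width := by have := h.le_width; omega
  width_le := h.width_le
  z_le := h.z_le
  e_le := h.e_le
  l_le := hl
  k_pos := h.k_pos
  l_le_mul := by
    have := h.l_le_mul
    have := h.le_width
    have := h.width_le
    rw [Nat.add_mul]
    omega
  e_le_mul := h.e_le_mul
  count := by have := h.count; omega
  width := (h.mono hy).width
  area u hu := by
    have := h.area u (hu.trans hy)
    have h1 : (u : ℤ) ≤ y := by exact_mod_cast hu
    push_cast
    nlinarith [mul_nonneg (Int.natCast_nonneg y) (sub_nonneg.2 h1)]
  load_le t := by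
    rw [hg]
    have h1 := h.load_le t
    have h2 := h.load_le_l t
    split_ifs with ht
    · have := h2 ht.1
      omega
    · omega
  load_le_l t ht := by
    rw [hg]
    have := h.load_le_l t ht
    split_ifs <;> omega
  -- The new item is no wider than the column, by `le_width`.
  load_eq_zero t ht := by
    rw [hg, h.load_eq_zero t ht, if_neg, add_zero]
    have := h.le_width
    omega

/-- A single item has size at most `z` and would leave room for `y`. -/
theorem two_le_c (h : ColumnBin T x f st e l z k c m a) {y : ℕ} (hzy : z + y ≤ T)
    (hl : T < l + y) : 2 ≤ c := by
  by_contra! hc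
  have : c * z ≤ 1 * z := Nat.mul_le_mul_right _ (by omega)
  have := h.l_le_mul
  omega

theorem two_le_k (h : ColumnBin T x f st e l z k c m a) {y : ℕ} (hzy : z + y ≤ T)
    (he : T < e + y) : 2 ≤ k := by
  by_contra! hc
  have : k * z ≤ 1 * z := Nat.mul_le_mul_right _ (by omega)
  have := h.e_le_mul
  omega

/-- Open a new column. -/
theorem column (h : ColumnBin T x f st e l z k c m a) {y : ℕ} (hy : y ≤ x) (hl : T < l + y)
    (he : e + y ≤ T)
    {g : ℕ → ℕ} (hg : ∀ t, g t = f t + if e + 1 ≤ t ∧ t < e + 1 + y then y else 0) :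
    ColumnBin T y g (e + 1) (e + y) y z (k + 1) 1 (m + 1) (a + y ^ 2) where
  st_pos := by omega
  le_width := by omega
  width_le := by have := h.le_width; have := h.width_le; omega
  z_le := by have := h.z_le; omega
  e_le := he
  l_le := by omega
  k_pos := by omega
  l_le_mul := by have := h.le_width; have := h.width_le; omega
  e_le_mul := by
    have := h.le_width
    have := h.width_le
    have := h.e_le_mul
    rw [Nat.add_mul]
    omega
  count := by
    have := h.count
    have := h.two_le_c (y := y) (by have := h.z_le; omega) hl
    omega
  width := by
    have h1 := (h.mono hy).width
    have h2 := h.k_pos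
    obtain ⟨k, rfl⟩ := Nat.exists_eq_add_of_le' h2
    simp only [Nat.add_sub_cancel] at h1 ⊢
    rw [Nat.add_mul]
    omega
  -- The old bound is used at `y`, the largest admissible value, because the closed column contains
  -- only items of size at least `y`. Passing from `y` to `u` is harmless as `e ≤ k * z`.
  area u hu := by
    have h0 := h.area y hy
    have h1 : (u : ℤ) ≤ y := by exact_mod_cast hu
    have h2 : (e : ℤ) ≤ k * z := by exact_mod_cast h.e_le_mul
    have h3 : (T : ℤ) ≤ l + y := by exact_mod_cast hl.le
    push_cast
    nlinarith [mul_nonneg (sub_nonneg.2 h1) (sub_nonneg.2 h2),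
      mul_nonneg (Int.natCast_nonneg y) (sub_nonneg.2 h3)]
  load_le t := by
    rw [hg]
    have h1 := h.load_le t
    split_ifs with ht
    · have := h.load_eq_zero t (by omega)
      omega
    · omega
  load_le_l t ht := by
    rw [hg, h.load_eq_zero t (by omega)]
    split_ifs <;> omega
  load_eq_zero t ht := by
    rw [hg, h.load_eq_zero t (by omega), if_neg (by omega)]

/-! ### Item count and area of bins that reject an item. -/

/-- A full bin contains at least four items. -/
theorem four_le (h : ColumnBin T x f st e l z k c m a) {y : ℕ} (hzy : z + y ≤ T)
    (hl : T < l + y) (he : T < e + y) : 4 ≤ m := by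
  have := h.two_le_c hzy hl
  have := h.two_le_k hzy he
  have := h.count
  omega

theorem area_of_full (h : ColumnBin T x f st e l z k c m a) (hl : T < l + x) :
    (z : ℤ) ^ 2 + (T - z) * (e - z) + x * ((k - 1) * z - e + T - x) ≤ a := by
  have h0 := h.area x le_rfl
  have h3 : (T : ℤ) ≤ l + x := by exact_mod_cast hl.le
  nlinarith [mul_nonneg (Int.natCast_nonneg x) (sub_nonneg.2 h3)]

/-- In `area_of_full` the coefficient of `e` is `T - z - x ≥ 0`, so `e` may be replaced by its lower
bound `T - x`. -/
theorem area_of_full' (h : ColumnBin T x f st e l z k c m a) (hl : T < l + x) (he : T < e + x)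
    (hzx : z + x ≤ T) :
    (z : ℤ) ^ 2 + (T - z) ^ 2 + x * (k * z - T) ≤ a := by
  have h0 := h.area_of_full hl
  have h3 : (T : ℤ) ≤ e + x := by exact_mod_cast he.le
  have h4 : (z : ℤ) + x ≤ T := by exact_mod_cast hzx
  nlinarith [mul_nonneg (sub_nonneg.2 h4) (sub_nonneg.2 h3)]

/-- Area of a full bin whose first item is large. -/
theorem area_large (h : ColumnBin T x f st e l z k c m a) (hl : T < l + x) (he : T < e + x)
    (hzx : z + x ≤ T) (hz : T < 2 * z) : 4 * T ^ 2 ≤ 9 * a := by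
  have h0 := h.area_of_full' hl he hzx
  have hk : (2 : ℤ) ≤ k := by exact_mod_cast h.two_le_k hzx he
  have hz' : (T : ℤ) ≤ 2 * z := by exact_mod_cast hz.le
  have h1 : (0 : ℤ) ≤ x * (k * z - T) := by
    refine mul_nonneg (Int.natCast_nonneg _) ?_
    nlinarith [mul_le_mul_of_nonneg_right hk (Int.natCast_nonneg z)]
  zify
  -- Already `z² + (T - z)² ≥ T² / 2`.
  nlinarith [sq_nonneg ((2 : ℤ) * z - T), sq_nonneg (T : ℤ)]

/-- Area of a full bin whose first item is medium. -/
theorem area_medium (h : ColumnBin T x f st e l z k c m a) (hl : T < l + x) (he : T < e + x)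
    (hz : 2 * z ≤ T) (hz3 : T < 3 * z) : 4 * T ^ 2 ≤ 9 * a := by
  have hxz : x ≤ z := by have := h.le_width; have := h.width_le; omega
  have hzx : z + x ≤ T := by omega
  have h0 := h.area_of_full' hl he hzx
  have hk := h.two_le_k hzx he
  have e1 : (2 : ℤ) * z ≤ T := by exact_mod_cast hz
  have e2 : (T : ℤ) ≤ 3 * z := by exact_mod_cast hz3.le
  have e3 : (x : ℤ) ≤ z := by exact_mod_cast hxz
  have e4 : (0 : ℤ) ≤ x := Int.natCast_nonneg x
  have e5 : (0 : ℤ) ≤ T := Int.natCast_nonneg T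
  zify
  rcases hk.eq_or_lt with rfl | hk
  · have hw : (z : ℤ) + x ≤ e := by exact_mod_cast (by simpa using h.width)
    have h1 := h.area_of_full hl
    push_cast at h0 h1
    -- The bounds from `e ≥ T - x` and `e ≥ z + x` agree at `x = (T - z) / 2`. The first decreases
    -- in `x`; the second is concave and only needs checking at this point and at `x = z`. The
    -- extreme case is `x = z = T / 3`.
    rcases le_total (2 * (x : ℤ)) (T - z) with hx | hx
    · nlinarith [mul_nonneg (sub_nonneg.2 hx) (sub_nonneg.2 e1),
        mul_nonneg (sub_nonneg.2 e2) (sub_nonneg.2 e2),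
        mul_nonneg (sub_nonneg.2 e2) e5]
    · have h2 : (z : ℤ) ^ 2 + x * (2 * T - z - 2 * x) ≤ a := by
        nlinarith [mul_nonneg (sub_nonneg.2 hw) (sub_nonneg.2 (by linarith : (z : ℤ) + x ≤ T))]
      nlinarith [mul_nonneg (sub_nonneg.2 hx) (sub_nonneg.2 e3),
        mul_nonneg (sub_nonneg.2 e2) (sub_nonneg.2 e2), mul_nonneg (sub_nonneg.2 e1) (sub_nonneg.2 e2),
        mul_nonneg (sub_nonneg.2 e2) e5]
  · have hk' : (3 : ℤ) ≤ k := by exact_mod_cast hk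
    have h1 : (0 : ℤ) ≤ x * (k * z - T) := by
      refine mul_nonneg e4 ?_
      nlinarith [mul_le_mul_of_nonneg_right hk' (Int.natCast_nonneg z)]
    nlinarith [sq_nonneg ((2 : ℤ) * z - T), sq_nonneg (T : ℤ)]

/-- Area of a full bin whose first item is small. -/
theorem area_small (h : ColumnBin T x f st e l z k c m a) (hl : T < l + x) (he : T < e + x)
    (hz3 : 3 * z ≤ T) : 5 * T ^ 2 ≤ 9 * a := by
  have hxz : x ≤ z := by have := h.le_width; have := h.width_le; omega
  have hzx : z + x ≤ T := by omega
  have h0 := h.area_of_full' hl he hzx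
  -- Two columns have width at most 2T/3, which leaves room for a third.
  have hk : 3 ≤ k := by
    by_contra! hc
    have : k * z ≤ 2 * z := Nat.mul_le_mul_right _ (by omega)
    have := h.e_le_mul
    omega
  have e2 : 3 * (z : ℤ) ≤ T := by exact_mod_cast hz3
  have e3 : (x : ℤ) ≤ z := by exact_mod_cast hxz
  have e4 : (0 : ℤ) ≤ x := Int.natCast_nonneg x
  have e5 : (0 : ℤ) ≤ T := Int.natCast_nonneg T
  zify
  rcases hk.eq_or_lt with rfl | hk
  · have hw : (z : ℤ) + 2 * x ≤ e := by exact_mod_cast (by simpa using h.width)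
    have h1 := h.area_of_full hl
    push_cast at h0 h1
    -- As for medium items, now with `e ≥ z + 2 * x` and the bounds meeting at `x = (T - z) / 3`.
    rcases le_total (3 * (x : ℤ)) (T - z) with hx | hx
    · nlinarith [mul_nonneg (sub_nonneg.2 hx) (sub_nonneg.2 e2),
        mul_nonneg (sub_nonneg.2 e2) (sub_nonneg.2 e2),
        mul_nonneg (sub_nonneg.2 e2) e5]
    · have h2 : (z : ℤ) ^ 2 + x * (3 * T - z - 3 * x) ≤ a := by
        nlinarith [mul_nonneg (sub_nonneg.2 hw) (sub_nonneg.2 (by linarith : (z : ℤ) + x ≤ T))]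
      have e6 : (T : ℤ) ≤ 4 * z := by linarith
      nlinarith [mul_nonneg (sub_nonneg.2 hx) (sub_nonneg.2 e3),
        mul_nonneg (sub_nonneg.2 e2) (sub_nonneg.2 e2), mul_nonneg (sub_nonneg.2 e2) (sub_nonneg.2 e6),
        mul_nonneg (sub_nonneg.2 e2) e5]
  · have hk' : (4 : ℤ) ≤ k := by exact_mod_cast hk
    rcases le_total (T : ℤ) (4 * z) with h4 | h4
    · have h1 : (0 : ℤ) ≤ x * (k * z - T) := by
        refine mul_nonneg e4 ?_
        nlinarith [mul_le_mul_of_nonneg_right hk' (Int.natCast_nonneg z)]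
      nlinarith [mul_nonneg (sub_nonneg.2 e2) e5, mul_nonneg (sub_nonneg.2 e2) (sub_nonneg.2 e2)]
    -- Here `k * z - T ≥ e - T ≥ -x`, so the area is at least `z² + (T - z)² - x² ≥ (T - z)² ≥ 9/16
    -- * T²`.
    · have h1 : (0 : ℤ) ≤ x * (k * z - T + x) := by
        refine mul_nonneg e4 ?_
        have h5 : (e : ℤ) ≤ k * z := by exact_mod_cast h.e_le_mul
        have h6 : (T : ℤ) ≤ e + x := by exact_mod_cast he.le
        linarith
      nlinarith [mul_nonneg (sub_nonneg.2 h4) e5, mul_nonneg (sub_nonneg.2 h4) (sub_nonneg.2 h4),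
        mul_nonneg (sub_nonneg.2 e3) e4, mul_nonneg (sub_nonneg.2 e3) (e4.trans e3)]

end ColumnBin

/-! ### The packing algorithm -/

namespace DemandInstance

/-- State of the packing algorithm. The items in `done` are packed. Bins `0, …, L - 1` start with
a large item, of size `big (j + 1)` in bin `j`; those with `j < q` contain nothing else, and bin `q`
is being filled. Bins `L, …, L + r - 1` contain no large item, and the last one is being filled. In
either bin being filled, the current column starts at slot `st` and has load `l`, and the columns
occupy the slots up to `e`. -/
structure Config (I : DemandInstance) where
  done : Finset (Fin I.n)
  bin : Fin I.n → ℕ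
  start : Fin I.n → ℕ
  big : ℕ → ℕ
  L : ℕ
  q : ℕ
  st₁ : ℕ
  e₁ : ℕ
  l₁ : ℕ
  r : ℕ
  st₂ : ℕ
  e₂ : ℕ
  l₂ : ℕ

namespace Config

variable {I : DemandInstance}

/-- Nothing is packed, and no bin is open. -/
def init (I : DemandInstance) : Config I where
  done := ∅
  bin _ := 0
  start _ := 0
  big := Function.update 0 0 (I.T + 1)
  L := 0
  q := 0
  st₁ := 0
  e₁ := I.T + 1
  l₁ := I.T + 1
  r := 0
  st₂ := 0
  e₂ := I.T + 1
  l₂ := I.T + 1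

/-- Put item `i` into bin `j` at slot `a`. -/
def put (c : Config I) (i : Fin I.n) (j a : ℕ) : Config I :=
  { c with
    done := insert i c.done
    bin := Function.update c.bin i j
    start := Function.update c.start i a }

/-- Pack item `i`. -/
def step (c : Config I) (i : Fin I.n) : Config I :=
  if I.T < I.h i + I.h i then
    { c.put i c.L 1 with
      big := Function.update c.big (c.L + 1) (I.h i), L := c.L + 1, q := c.L + 1 }
  else if c.l₁ + I.h i ≤ I.T then
    { c.put i c.q c.st₁ with l₁ := c.l₁ + I.h i }
  else if c.e₁ + I.h i ≤ I.T then
    { c.put i c.q (c.e₁ + 1) with st₁ := c.e₁ + 1, e₁ := c.e₁ + I.h i, l₁ := I.h i }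
  -- By the index shift, `big q` is the large item of bin `q - 1`, and for `q = 0` it is the
  -- sentinel.
  else if c.big c.q + I.h i ≤ I.T then
    { c.put i (c.q - 1) 1 with
      q := c.q - 1, st₁ := 1, e₁ := c.big c.q, l₁ := c.big c.q + I.h i }
  else if c.l₂ + I.h i ≤ I.T then
    { c.put i (c.L + c.r - 1) c.st₂ with l₂ := c.l₂ + I.h i }
  else if c.e₂ + I.h i ≤ I.T then
    { c.put i (c.L + c.r - 1) (c.e₂ + 1) with
      st₂ := c.e₂ + 1, e₂ := c.e₂ + I.h i, l₂ := I.h i }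
  else
    { c.put i (c.L + c.r) 1 with r := c.r + 1, st₂ := 1, e₂ := I.h i, l₂ := I.h i }

/-- Load in slot `t` of bin `j`. -/
def load (c : Config I) (j t : ℕ) : ℕ :=
  I.load (c.done.filter fun i => c.bin i = j) c.start t

theorem load_eq_sum (hQ : I.IsSquareSquare) (c : Config I) (j t : ℕ) : c.load j t =
    ∑ i ∈ c.done, if c.bin i = j ∧ c.start i ≤ t ∧ t < c.start i + I.h i then I.h i else 0 := by
  unfold load DemandInstance.load
  rw [Finset.filter_filter, Finset.sum_filter]
  simp only [hQ.2]

theorem load_put (hQ : I.IsSquareSquare) (c : Config I) {i : Fin I.n} (hi : i ∉ c.done)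
    (j a j' t : ℕ) : (c.put i j a).load j' t =
      c.load j' t + if j' = j ∧ a ≤ t ∧ t < a + I.h i then I.h i else 0 := by
  rw [load_eq_sum hQ, load_eq_sum hQ]
  have hdone : (c.put i j a).done = insert i c.done := rfl
  rw [hdone, Finset.sum_insert hi, add_comm]
  congr 1
  · refine Finset.sum_congr rfl fun k hk => ?_
    have hne : k ≠ i := fun h => hi (h ▸ hk)
    have h1 : (c.put i j a).bin k = c.bin k := Function.update_of_ne hne _ _
    have h2 : (c.put i j a).start k = c.start k := Function.update_of_ne hne _ _
    simp only [h1, h2]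
  · have h1 : (c.put i j a).bin i = j := Function.update_self _ _ _
    have h2 : (c.put i j a).start i = a := Function.update_self _ _ _
    simp only [h1, h2, eq_comm (a := j)]

/-! ### The invariant and its preservation. -/

/-- Invariant of the packing algorithm. The number `x` separates the sizes of the packed items from
the sizes of the others. Of the bins `L, …, L + r - 1`, the first `K` begin with an item larger than
a third of the bin, the others do not; the last one begins with an item of size `z₂`. The bins that
are being filled contain `m₁` and `m₂` items, of total area `a₁` and `a₂`. -/
structure Inv (c : Config I) (x K z₂ m₁ a₁ m₂ a₂ : ℕ) : Prop where
  le_done : ∀ i ∈ c.done, x ≤ I.h i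
  le_rest : ∀ i ∉ c.done, I.h i ≤ x
  valid : ∀ i ∈ c.done, c.bin i < c.L + c.r ∧ 1 ≤ c.start i ∧ c.start i + I.h i ≤ I.T + 1
  load_le : ∀ j t, c.load j t ≤ I.T
  large_phase : I.T < 2 * x → c.r = 0 ∧ c.q = c.L
  q_le : c.q ≤ c.L
  big_zero : c.big 0 = I.T + 1
  big_anti : ∀ j k, j ≤ k → k < c.L → c.big (k + 1) ≤ c.big (j + 1)
  owner : ∀ j < c.L, ∃ i ∈ c.done, c.bin i = j ∧ I.h i = c.big (j + 1) ∧ I.T < 2 * I.h i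
  fresh : ∀ j < c.q, ∀ t, c.load j t ≤ c.big (j + 1) ∧ (c.big (j + 1) < t → c.load j t = 0)
  K_le : K ≤ c.r
  L_add_K_le : c.L + K ≤ I.OPT
  L_add_r_le : c.L + c.r ≤ 2 * I.OPT
  first : (c.q = c.L ∧ c.e₁ = I.T + 1 ∧ c.l₁ = I.T + 1 ∧ m₁ = 0 ∧ a₁ = 0) ∨
    (c.q < c.L ∧ ∃ k n, ColumnBin I.T x (c.load c.q) c.st₁ c.e₁ c.l₁ (c.big (c.q + 1)) k n m₁ a₁)
  second : (c.r = 0 ∧ c.e₂ = I.T + 1 ∧ c.l₂ = I.T + 1 ∧ m₂ = 0 ∧ a₂ = 0) ∨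
    (0 < c.r ∧ 2 * z₂ ≤ I.T ∧ (K = c.r ↔ I.T < 3 * z₂) ∧
      ∃ k n, ColumnBin I.T x (c.load (c.L + c.r - 1)) c.st₂ c.e₂ c.l₂ z₂ k n m₂ a₂)
  -- Closed bins count four items each. Truncated subtraction gives 0 closed bins when none is open,
  -- that is for `q = L` or `r = 0`.
  count : 4 * (c.L - 1 - c.q) + m₁ + c.q + 4 * (c.r - 1) + m₂ ≤ c.done.card
  -- The minimum with `r - 1` excludes the bin being filled, whose area is `a₂`.
  area : 9 * ∑ j ∈ Finset.range c.q, c.big (j + 1) ^ 2 + 4 * I.T ^ 2 * (c.L - 1 - c.q) + 9 * a₁ +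
      4 * I.T ^ 2 * min K (c.r - 1) + 5 * I.T ^ 2 * (c.r - 1 - K) + 9 * a₂ ≤
    9 * ∑ i ∈ c.done, I.h i ^ 2

theorem inv_init (hI : I.Fits) (hQ : I.IsSquareSquare) : (init I).Inv I.T 0 0 0 0 0 0 where
  le_done i hi := by simp [init] at hi
  le_rest i _ := hQ.1 ▸ (hI i).1
  valid i hi := by simp [init] at hi
  load_le j t := by rw [load_eq_sum hQ]; exact Nat.zero_le _
  large_phase _ := ⟨rfl, rfl⟩
  q_le := le_rfl
  big_zero := by simp [init]
  big_anti j k _ hk := by simp [init] at hk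
  owner j hj := by simp [init] at hj
  fresh j hj := by simp [init] at hj
  K_le := le_rfl
  L_add_K_le := Nat.zero_le _
  L_add_r_le := Nat.zero_le _
  first := Or.inl ⟨rfl, rfl, rfl, rfl, rfl⟩
  second := Or.inl ⟨rfl, rfl, rfl, rfl, rfl⟩
  count := by simp [init]
  area := by simp [init]

variable {c : Config I} {x K z₂ m₁ a₁ m₂ a₂ : ℕ}

/-- Lowers the threshold to the size of the next item before that item is packed. -/
theorem Inv.mono (h : c.Inv x K z₂ m₁ a₁ m₂ a₂) {i : Fin I.n} (hi : i ∉ c.done)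
    (hmax : ∀ k ∉ c.done, I.h k ≤ I.h i) : c.Inv (I.h i) K z₂ m₁ a₁ m₂ a₂ where
  __ := h
  le_done k hk := (h.le_rest i hi).trans (h.le_done k hk)
  le_rest := hmax
  large_phase hx := h.large_phase (hx.trans_le (Nat.mul_le_mul_left _ (h.le_rest i hi)))
  first := h.first.imp_right fun ⟨h1, k, n, h2⟩ => ⟨h1, k, n, h2.mono (h.le_rest i hi)⟩
  second := h.second.imp_right fun ⟨h1, h3, h4, k, n, h2⟩ =>
    ⟨h1, h3, h4, k, n, h2.mono (h.le_rest i hi)⟩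

/-- A bin that is not opened is empty. -/
theorem Inv.load_eq_zero (h : c.Inv x K z₂ m₁ a₁ m₂ a₂) {j : ℕ} (hj : c.L + c.r ≤ j) (t : ℕ) :
    c.load j t = 0 := by
  have : (c.done.filter fun i => c.bin i = j) = ∅ := by
    refine Finset.filter_eq_empty_iff.2 fun i hi => ?_
    have := (h.valid i hi).1
    omega
  simp [load, DemandInstance.load, this]

theorem Inv.big_pos (h : c.Inv x K z₂ m₁ a₁ m₂ a₂) {j : ℕ} (hj : j < c.L) :
    I.T < 2 * c.big (j + 1) ∧ c.big (j + 1) ≤ I.T ∧ x ≤ c.big (j + 1) := by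
  obtain ⟨i, hi, h1, h2, h3⟩ := h.owner j hj
  have := h.valid i hi
  have := h.le_done i hi
  omega

/-- Bookkeeping common to stacking and opening a column; the geometry enters only through `hb`. -/
theorem Inv.put_first (hQ : I.IsSquareSquare) {i : Fin I.n}
    (h : c.Inv (I.h i) K z₂ m₁ a₁ m₂ a₂) (hi : i ∉ c.done) (hx : 2 * I.h i ≤ I.T) {a st e l : ℕ}
    (hq : c.q < c.L) (ha : 1 ≤ a) (ha' : a + I.h i ≤ I.T + 1)
    (hb : ∃ k n, ColumnBin I.T (I.h i) ((c.put i c.q a).load c.q) st e l (c.big (c.q + 1)) k n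
      (m₁ + 1) (a₁ + I.h i ^ 2)) :
    Inv { c.put i c.q a with st₁ := st, e₁ := e, l₁ := l } (I.h i) K z₂
      (m₁ + 1) (a₁ + I.h i ^ 2) m₂ a₂ := by
  have hload : ∀ j, j ≠ c.q → (c.put i c.q a).load j = c.load j := fun j hj => by
    funext t
    rw [load_put hQ c hi, if_neg (fun h => hj h.1), add_zero]
  refine
    { le_done := fun k hk => ?_
      le_rest := fun k hk => h.le_rest k fun hk' => hk (Finset.mem_insert_of_mem hk')
      valid := fun k hk => ?_
      load_le := fun j t => ?_
      large_phase := fun h => absurd h (by omega)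
      q_le := h.q_le
      big_zero := h.big_zero
      big_anti := h.big_anti
      owner := fun j hj => ?_
      fresh := fun j hj t => ?_
      K_le := h.K_le
      L_add_K_le := h.L_add_K_le
      L_add_r_le := h.L_add_r_le
      first := Or.inr ⟨hq, hb⟩
      second := h.second.imp_right fun ⟨h1, h3, h4, k, n, h2⟩ => ⟨h1, h3, h4, k, n, ?_⟩
      count := ?_
      area := ?_ }
  · rcases Finset.mem_insert.1 hk with rfl | hk
    · exact le_rfl
    · exact h.le_done k hk
  · by_cases hki : k = i
    · subst hki
      simp only [put, Function.update_self]
      omega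
    · simp only [put, Function.update_of_ne hki]
      exact h.valid k ((Finset.mem_insert.1 hk).resolve_left hki)
  · show (c.put i c.q a).load j t ≤ I.T
    by_cases hj : j = c.q
    · subst hj
      obtain ⟨k, n, hb⟩ := hb
      exact hb.load_le t
    · rw [hload j hj]
      exact h.load_le j t
  · obtain ⟨k, hk, h1⟩ := h.owner j hj
    have hki : k ≠ i := fun h => hi (h ▸ hk)
    exact ⟨k, Finset.mem_insert_of_mem hk, by simpa only [put, Function.update_of_ne hki] using h1⟩
  · show (c.put i c.q a).load j t ≤ _ ∧ (_ → (c.put i c.q a).load j t = 0)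
    rw [hload j (by dsimp only [put] at hj; omega)]
    exact h.fresh j hj t
  · have := h.count
    simp only [put, Finset.card_insert_of_notMem hi]
    omega
  · have := h.area
    simp only [put, Finset.sum_insert hi]
    omega
  · show ColumnBin _ _ ((c.put i c.q a).load (c.L + c.r - 1)) _ _ _ _ _ _ _ _
    rw [hload _ (by omega)]
    exact h2

theorem Inv.put_second (hQ : I.IsSquareSquare) {i : Fin I.n}
    (h : c.Inv (I.h i) K z₂ m₁ a₁ m₂ a₂) (hi : i ∉ c.done) (hx : 2 * I.h i ≤ I.T) {a st e l : ℕ}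
    (hr : 0 < c.r) (ha : 1 ≤ a) (ha' : a + I.h i ≤ I.T + 1) (hz : 2 * z₂ ≤ I.T)
    (hK : K = c.r ↔ I.T < 3 * z₂)
    (hb : ∃ k n, ColumnBin I.T (I.h i) ((c.put i (c.L + c.r - 1) a).load (c.L + c.r - 1))
      st e l z₂ k n (m₂ + 1) (a₂ + I.h i ^ 2)) :
    Inv { c.put i (c.L + c.r - 1) a with st₂ := st, e₂ := e, l₂ := l } (I.h i) K z₂
      m₁ a₁ (m₂ + 1) (a₂ + I.h i ^ 2) := by
  have hload : ∀ j, j ≠ c.L + c.r - 1 → (c.put i (c.L + c.r - 1) a).load j = c.load j :=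
    fun j hj => by
      funext t
      rw [load_put hQ c hi, if_neg (fun h => hj h.1), add_zero]
  have hqL := h.q_le
  refine
    { le_done := fun k hk => ?_
      le_rest := fun k hk => h.le_rest k fun hk' => hk (Finset.mem_insert_of_mem hk')
      valid := fun k hk => ?_
      load_le := fun j t => ?_
      large_phase := fun h => absurd h (by omega)
      q_le := h.q_le
      big_zero := h.big_zero
      big_anti := h.big_anti
      owner := fun j hj => ?_
      fresh := fun j hj t => ?_
      K_le := h.K_le
      L_add_K_le := h.L_add_K_le
      L_add_r_le := h.L_add_r_le
      first := h.first.imp_right fun ⟨h1, k, n, h2⟩ => ⟨h1, k, n, ?_⟩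
      second := Or.inr ⟨hr, hz, hK, hb⟩
      count := ?_
      area := ?_ }
  · rcases Finset.mem_insert.1 hk with rfl | hk
    · exact le_rfl
    · exact h.le_done k hk
  · by_cases hki : k = i
    · subst hki
      simp only [put, Function.update_self]
      omega
    · simp only [put, Function.update_of_ne hki]
      exact h.valid k ((Finset.mem_insert.1 hk).resolve_left hki)
  · show (c.put i (c.L + c.r - 1) a).load j t ≤ I.T
    by_cases hj : j = c.L + c.r - 1
    · subst hj
      obtain ⟨k, n, hb⟩ := hb
      exact hb.load_le t
    · rw [hload j hj]
      exact h.load_le j t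
  · obtain ⟨k, hk, h1⟩ := h.owner j hj
    have hki : k ≠ i := fun h => hi (h ▸ hk)
    exact ⟨k, Finset.mem_insert_of_mem hk, by simpa only [put, Function.update_of_ne hki] using h1⟩
  · show (c.put i (c.L + c.r - 1) a).load j t ≤ _ ∧
      (_ → (c.put i (c.L + c.r - 1) a).load j t = 0)
    rw [hload j (by dsimp only [put] at hj; omega)]
    exact h.fresh j hj t
  · have := h.count
    simp only [put, Finset.card_insert_of_notMem hi]
    omega
  · have := h.area
    simp only [put, Finset.sum_insert hi]
    omega
  · show ColumnBin _ _ ((c.put i (c.L + c.r - 1) a).load c.q) _ _ _ _ _ _ _ _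
    rw [hload _ (by omega)]
    exact h2

/-- Open a bin with a large item. -/
theorem Inv.put_large (hI : I.Fits) (hQ : I.IsSquareSquare) {i : Fin I.n}
    (h : c.Inv (I.h i) K z₂ m₁ a₁ m₂ a₂) (hi : i ∉ c.done) (hx : I.T < 2 * I.h i) :
    Inv { c.put i c.L 1 with
      big := Function.update c.big (c.L + 1) (I.h i), L := c.L + 1, q := c.L + 1 }
      (I.h i) K z₂ m₁ a₁ m₂ a₂ := by
  classical
  obtain ⟨hr, hq⟩ := h.large_phase hx
  have hT : I.h i ≤ I.T := hQ.1 ▸ (hI i).1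
  have hload : ∀ j t, (c.put i c.L 1).load j t =
      c.load j t + if j = c.L ∧ 1 ≤ t ∧ t < 1 + I.h i then I.h i else 0 := load_put hQ c hi c.L 1
  have hzero : ∀ t, c.load c.L t = 0 := h.load_eq_zero (by omega)
  have hbig : ∀ j < c.L, Function.update c.big (c.L + 1) (I.h i) (j + 1) = c.big (j + 1) :=
    fun j hj => Function.update_of_ne (by omega) _ _
  have hK : K = 0 := by have := h.K_le; omega
  -- All packed items are still large, and by `count` there are at least `L` of them.
  have hOPT : c.L + 1 ≤ I.OPT := by
    obtain ⟨b, A, hsol⟩ := exists_isSolution_OPT hI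
    have h1 := hsol.card_large_le hQ (insert i c.done) fun k hk => by
      rcases Finset.mem_insert.1 hk with rfl | hk
      · exact hx
      · have := h.le_done k hk
        omega
    rw [Finset.card_insert_of_notMem hi] at h1
    have := h.count
    omega
  refine
    { le_done := fun k hk => ?_
      le_rest := fun k hk => h.le_rest k fun hk' => hk (Finset.mem_insert_of_mem hk')
      valid := fun k hk => ?_
      load_le := fun j t => ?_
      large_phase := fun _ => ⟨hr, rfl⟩
      q_le := le_rfl
      big_zero := by simpa using h.big_zero
      big_anti := fun j k hjk hk => ?_
      owner := fun j hj => ?_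
      fresh := fun j hj t => ?_
      K_le := h.K_le
      L_add_K_le := by dsimp only; omega
      L_add_r_le := by dsimp only [put]; omega
      first := Or.inl ⟨rfl, ?_⟩
      second := Or.inl ?_
      count := ?_
      area := ?_ }
  · rcases Finset.mem_insert.1 hk with rfl | hk
    · exact le_rfl
    · exact h.le_done k hk
  · by_cases hki : k = i
    · subst hki
      simp only [put, Function.update_self]
      omega
    · simp only [put, Function.update_of_ne hki]
      have := h.valid k ((Finset.mem_insert.1 hk).resolve_left hki)
      omega
  · show (c.put i c.L 1).load j t ≤ I.T
    rw [hload]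
    split_ifs with hj
    · rw [hj.1, hzero]
      omega
    · exact h.load_le j t
  · dsimp only at hk ⊢
    rcases Nat.lt_succ_iff_lt_or_eq.1 hk with hk | rfl
    · rw [hbig j (by omega), hbig k hk]
      exact h.big_anti j k hjk hk
    · rw [Function.update_self]
      rcases hjk.lt_or_eq with hj | rfl
      · rw [hbig j hj]
        exact (h.big_pos hj).2.2
      · rw [Function.update_self]
  · dsimp only at hj ⊢
    rcases Nat.lt_succ_iff_lt_or_eq.1 hj with hj | rfl
    · obtain ⟨k, hk, h1⟩ := h.owner j hj
      have hki : k ≠ i := fun h => hi (h ▸ hk)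
      refine ⟨k, Finset.mem_insert_of_mem hk, ?_⟩
      rw [hbig j hj]
      simpa only [put, Function.update_of_ne hki] using h1
    · exact ⟨i, Finset.mem_insert_self _ _, by simp [put], by simp, hx⟩
  · show (c.put i c.L 1).load j t ≤ Function.update c.big (c.L + 1) (I.h i) (j + 1) ∧
      (Function.update c.big (c.L + 1) (I.h i) (j + 1) < t → (c.put i c.L 1).load j t = 0)
    rw [hload]
    rcases Nat.lt_succ_iff_lt_or_eq.1 hj with hj | rfl
    · rw [hbig j hj, if_neg (by omega)]
      exact h.fresh j (by omega) t
    · rw [hzero, Function.update_self, zero_add]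
      split_ifs <;> omega
  · rcases h.first with h1 | h1
    · exact h1.2
    · omega
  · rcases h.second with h1 | h1
    · exact h1
    · omega
  · have := h.count
    simp only [put, Finset.card_insert_of_notMem hi]
    omega
  · have h1 := h.area
    rw [hq] at h1
    simp only [put, Finset.sum_insert hi, Finset.sum_range_succ, Function.update_self]
    rw [Finset.sum_congr rfl fun j hj => by rw [hbig j (Finset.mem_range.1 hj)]]
    have h2 : c.L - 1 - c.L = 0 := by omega
    have h3 : c.L + 1 - 1 - (c.L + 1) = 0 := by omega
    rw [h2] at h1
    rw [h3]
    omega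

/-- Go on to the next bin with a large item. -/
theorem Inv.next_large {i : Fin I.n} (h : c.Inv (I.h i) K z₂ m₁ a₁ m₂ a₂)
    (hx : 2 * I.h i ≤ I.T) (hl : I.T < c.l₁ + I.h i) (he : I.T < c.e₁ + I.h i)
    (hb : c.big c.q + I.h i ≤ I.T) :
    0 < c.q ∧ Inv { c with q := c.q - 1, st₁ := 1, e₁ := c.big c.q, l₁ := c.big c.q }
      (I.h i) K z₂ 1 (c.big c.q ^ 2) m₂ a₂ := by
  -- For `q = 0` the sentinel contradicts `hb`.
  have hq : 0 < c.q := by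
    by_contra! h0
    have := h.big_zero
    rw [Nat.le_zero.1 h0] at hb
    omega
  refine ⟨hq, ?_⟩
  have hqL := h.q_le
  obtain ⟨q, hq'⟩ : ∃ q, c.q = q + 1 := ⟨c.q - 1, by omega⟩
  have hpos := h.big_pos (j := q) (by omega)
  have hfresh := h.fresh q (by omega)
  have hcol : ColumnBin I.T (I.h i) (c.load q) 1 (c.big (q + 1)) (c.big (q + 1))
      (c.big (q + 1)) 1 1 1 (c.big (q + 1) ^ 2) :=
    (ColumnBin.single (by omega) (fun t => (hfresh t).1) fun t => (hfresh t).2).mono hpos.2.2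
  -- The bin left behind has a large item no larger than that of the next bin, so it too leaves room
  -- for `h i`, and the bounds for full bins apply.
  have hold : (c.q = c.L ∧ m₁ = 0 ∧ a₁ = 0) ∨ (c.q < c.L ∧ 4 ≤ m₁ ∧ 4 * I.T ^ 2 ≤ 9 * a₁) := by
    rcases h.first with h1 | ⟨h1, k, n, h2⟩
    · exact Or.inl ⟨h1.1, h1.2.2.2⟩
    · have h3 := h.big_anti q c.q (by omega) h1
      rw [hq'] at hb
      exact Or.inr ⟨h1, h2.four_le (by omega) hl he,
        h2.area_large hl he (by omega) (h.big_pos h1).1⟩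
  rw [hq', Nat.add_sub_cancel]
  refine
    { h with
      large_phase := fun h => absurd h (by omega)
      q_le := by dsimp only; omega
      fresh := fun j hj => h.fresh j (by dsimp only at hj; omega)
      first := Or.inr ⟨by dsimp only; omega, 1, 1, hcol⟩
      count := ?_
      area := ?_ }
  · have := h.count
    dsimp only
    omega
  · have h1 := h.area
    rw [hq', Finset.sum_range_succ] at h1
    dsimp only
    rcases hold with ⟨h2, h3, h4⟩ | ⟨h2, h3, h4⟩
    · have e1 : c.L - 1 - (q + 1) = 0 := by omega
      have e2 : c.L - 1 - q = 0 := by omega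
      rw [e1] at h1
      rw [e2]
      omega
    · have e2 : c.L - 1 - q = (c.L - 1 - (q + 1)) + 1 := by omega
      rw [e2, Nat.mul_add, Nat.mul_one]
      omega

/-! ### Why a further bin without a large item is affordable. -/

/-- Many large items do not fit together with an item of size `x`. -/
theorem Inv.le_card_filter (h : c.Inv x K z₂ m₁ a₁ m₂ a₂) {N : ℕ} (hN : N ≤ c.L)
    (hbig : ∀ j < N, I.T < c.big (j + 1) + x) :
    N ≤ (c.done.filter fun i => I.T < I.h i + x).card := by
  classical
  have : Finset.range N ⊆ (c.done.filter fun i => I.T < I.h i + x).image c.bin := by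
    intro j hj
    rw [Finset.mem_range] at hj
    obtain ⟨i, hi, h1, h2, _⟩ := h.owner j (by omega)
    exact Finset.mem_image.2 ⟨i, Finset.mem_filter.2 ⟨hi, h2 ▸ hbig j hj⟩, h1⟩
  simpa using (Finset.card_le_card this).trans Finset.card_image_le

/-- Among the bins that are still to be filled, bin `q - 1` has the smallest large item. -/
theorem Inv.lt_big_add (h : c.Inv x K z₂ m₁ a₁ m₂ a₂) (hb : I.T < c.big c.q + x) :
    ∀ j < c.q, I.T < c.big (j + 1) + x := by
  intro j hj
  have := h.q_le
  have := h.big_anti j (c.q - 1) (by omega) (by omega)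
  rw [Nat.sub_add_cancel (by omega)] at this
  omega

/-- An optimal solution needs yet another bin for the items larger than a third of the bin. -/
theorem Inv.lt_OPT_of_medium (hI : I.Fits) (hQ : I.IsSquareSquare) {i : Fin I.n}
    (h : c.Inv (I.h i) K z₂ m₁ a₁ m₂ a₂) (hi : i ∉ c.done)
    (hx : 2 * I.h i ≤ I.T) (hx3 : I.T < 3 * I.h i)
    (hl₁ : I.T < c.l₁ + I.h i) (he₁ : I.T < c.e₁ + I.h i)
    (hb : I.T < c.big c.q + I.h i)
    (hl₂ : I.T < c.l₂ + I.h i) (he₂ : I.T < c.e₂ + I.h i) : c.L + c.r + 1 ≤ I.OPT := by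
  classical
  obtain ⟨b, A, hsol⟩ := exists_isSolution_OPT hI
  have hbound := hsol.card_add_le hQ hx3 (insert i c.done)
    (c.done.filter fun k => I.T < I.h k + I.h i)
    (fun k hk => by
      rcases Finset.mem_insert.1 hk with rfl | hk
      · exact le_rfl
      · exact h.le_done k hk)
    ((Finset.filter_subset _ _).trans (Finset.subset_insert _ _))
    (fun k hk => (Finset.mem_filter.1 hk).2)
  rw [Finset.card_insert_of_notMem hi] at hbound
  have hbig := h.lt_big_add hb
  have hcount := h.count
  have hqL := h.q_le
  have hm₂ : c.r = 0 ∨ 4 ≤ m₂ := by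
    rcases h.second with h1 | ⟨_, h1, _, k, n, h2⟩
    · exact Or.inl h1.1
    · exact Or.inr (h2.four_le (by omega) hl₂ he₂)
  rcases h.first with h1 | ⟨h1, k, n, h2⟩
  · have := h.le_card_filter hqL hbig
    omega
  -- The bin being filled has weight 4 either way: four items, or a large item that excludes `h i`
  -- and so counts for `U`.
  · by_cases h3 : c.big (c.q + 1) + I.h i ≤ I.T
    · have := h.le_card_filter hqL hbig
      have := h2.four_le h3 hl₁ he₁
      omega
    · have := h.le_card_filter (N := c.q + 1) h1 fun j hj => by
        rcases Nat.lt_succ_iff_lt_or_eq.1 hj with hj | rfl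
        · exact hbig j hj
        · omega
      have := h2.count
      have := h2.k_pos
      have : n ≠ 0 := by
        rintro rfl
        have := h2.l_le_mul
        omega
      omega

/-- Area of the bins without a large item when another item does not fit into the last one. -/
theorem Inv.area_second (h : c.Inv x K z₂ m₁ a₁ m₂ a₂)
    (hl₂ : I.T < c.l₂ + x) (he₂ : I.T < c.e₂ + x) :
    4 * I.T ^ 2 * K + 5 * I.T ^ 2 * (c.r - K) ≤
      4 * I.T ^ 2 * min K (c.r - 1) + 5 * I.T ^ 2 * (c.r - 1 - K) + 9 * a₂ := by
  have hKr := h.K_le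
  rcases h.second with h3 | ⟨h3, h4, h5, k, n, h6⟩
  · have : K = 0 := by omega
    subst this
    simp [h3.1]
  · by_cases h7 : K = c.r
    · have := h6.area_medium hl₂ he₂ h4 (h5.1 h7)
      obtain ⟨r, hr⟩ : ∃ r, c.r = r + 1 := ⟨c.r - 1, by omega⟩
      have e1 : min (r + 1) (r + 1 - 1) = r := by omega
      have e2 : r + 1 - 1 - (r + 1) = 0 := by omega
      rw [h7, hr, e1, e2, Nat.sub_self, Nat.mul_add, Nat.mul_one]
      omega
    · have := h6.area_small hl₂ he₂ (not_lt.1 fun h8 => h7 (h5.2 h8))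
      obtain ⟨r, hr⟩ : ∃ r, c.r = K + r + 1 := ⟨c.r - K - 1, by omega⟩
      have e1 : min K (K + r + 1 - 1) = K := by omega
      have e2 : K + r + 1 - 1 - K = r := by omega
      have e3 : K + r + 1 - K = r + 1 := by omega
      rw [hr, e1, e2, e3, Nat.mul_add, Nat.mul_one]
      omega

/-- Area of the packed items when an item fits into none of the open bins. -/
theorem Inv.area_of_full {i : Fin I.n}
    (h : c.Inv (I.h i) K z₂ m₁ a₁ m₂ a₂) (hx : 3 * I.h i ≤ I.T)
    (hl₁ : I.T < c.l₁ + I.h i) (he₁ : I.T < c.e₁ + I.h i)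
    (hb : I.T < c.big c.q + I.h i)
    (hl₂ : I.T < c.l₂ + I.h i) (he₂ : I.T < c.e₂ + I.h i) :
    4 * I.T ^ 2 * c.L + 4 * I.T ^ 2 * K + 5 * I.T ^ 2 * (c.r - K) ≤
      9 * ∑ k ∈ c.done, I.h k ^ 2 := by
  -- An item that excludes a small one is larger than 2T/3 and needs no company to reach 4/9.
  have hsq : ∀ s, I.T < s + I.h i → 4 * I.T ^ 2 ≤ 9 * s ^ 2 := fun s hs => by
    have : 2 * I.T ≤ 3 * s := by omega
    nlinarith
  have h0 := h.area
  have hqL := h.q_le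
  have hKr := h.K_le
  have h1 : 4 * I.T ^ 2 * c.q ≤ 9 * ∑ j ∈ Finset.range c.q, c.big (j + 1) ^ 2 := by
    rw [Finset.mul_sum]
    have := Finset.card_nsmul_le_sum (Finset.range c.q) (fun j => 9 * c.big (j + 1) ^ 2)
      (4 * I.T ^ 2) fun j hj => hsq _ (h.lt_big_add hb j (Finset.mem_range.1 hj))
    simpa [mul_comm] using this
  have h2 : 4 * I.T ^ 2 * c.L ≤ 4 * I.T ^ 2 * c.q + 4 * I.T ^ 2 * (c.L - 1 - c.q) + 9 * a₁ := by
    rcases h.first with h3 | ⟨h3, k, n, h4⟩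
    · rw [h3.1]
      omega
    · have h5 : 4 * I.T ^ 2 ≤ 9 * a₁ := by
        by_cases h6 : c.big (c.q + 1) + I.h i ≤ I.T
        · exact h4.area_large hl₁ he₁ h6 (h.big_pos h3).1
        · exact (hsq _ (by omega)).trans (Nat.mul_le_mul_left _ h4.sq_le_area)
      have h6 : c.L = c.q + (c.L - 1 - c.q) + 1 := by omega
      calc 4 * I.T ^ 2 * c.L = 4 * I.T ^ 2 * (c.q + (c.L - 1 - c.q) + 1) := by rw [← h6]
        _ ≤ _ := by rw [Nat.mul_add, Nat.mul_add, Nat.mul_one]; omega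
  have h3 := h.area_second hl₂ he₂
  omega

/-- Opening another bin for a small item is justified. -/
theorem Inv.L_add_r_lt (hI : I.Fits) (hQ : I.IsSquareSquare) {i : Fin I.n}
    (h : c.Inv (I.h i) K z₂ m₁ a₁ m₂ a₂) (hi : i ∉ c.done) (hx : 3 * I.h i ≤ I.T)
    (hl₁ : I.T < c.l₁ + I.h i) (he₁ : I.T < c.e₁ + I.h i)
    (hb : I.T < c.big c.q + I.h i)
    (hl₂ : I.T < c.l₂ + I.h i) (he₂ : I.T < c.e₂ + I.h i) : c.L + c.r + 1 ≤ 2 * I.OPT := by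
  classical
  have harea := h.area_of_full hx hl₁ he₁ hb hl₂ he₂
  have hLK := h.L_add_K_le
  have hKr := h.K_le
  obtain ⟨b, A, hsol⟩ := exists_isSolution_OPT hI
  -- An item of size 0 adds no area, but it is rejected only if no bin is open at all.
  rcases Nat.eq_zero_or_pos (I.h i) with h0 | hpos
  · have := hsol.1 i
    have hr : c.r = 0 := by
      rcases h.second with h1 | ⟨_, _, _, k, n, h2⟩
      · exact h1.1
      · have := h2.l_le
        omega
    have hL : c.L = 0 := by
      rcases h.first with h1 | ⟨_, k, n, h2⟩
      · by_contra hL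
        have hqL := h.q_le
        have := (h.big_pos (j := c.q - 1) (by omega)).2.1
        rw [Nat.sub_add_cancel (by omega)] at this
        omega
      · have := h2.l_le
        omega
    omega
  · rcases Nat.lt_or_ge (c.r - K) (c.L + K) with h1 | h1
    · omega
    · have h2 : ∑ k ∈ insert i c.done, I.h k ^ 2 ≤ I.OPT * I.T ^ 2 :=
        (Finset.sum_le_sum_of_subset (Finset.subset_univ _)).trans (hsol.area_le hQ)
      rw [Finset.sum_insert hi] at h2
      obtain ⟨d, hd⟩ : ∃ d, c.r - K = c.L + K + d := ⟨c.r - K - (c.L + K), by omega⟩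
      have hr : c.r = c.L + 2 * K + d := by omega
      rw [hd] at harea
      have hx2 : 0 < I.h i ^ 2 := by positivity
      by_contra! h3
      have h4 : 2 * I.OPT * I.T ^ 2 ≤ (c.L + c.r) * I.T ^ 2 :=
        Nat.mul_le_mul_right _ (by omega)
      rw [hr] at h4
      -- Nine times the packed area is at least `(9 * (L + K) + 5 * d) * T²`, while `9 * (L + r) / 2
      -- = 9 * (L + K) + 9 * d / 2`; the positive square of the new item makes the comparison
      -- strict.
      nlinarith [Nat.zero_le (I.T ^ 2 * d)]

/-- Open a bin without a large item. -/
theorem Inv.put_new (hI : I.Fits) (hQ : I.IsSquareSquare) {i : Fin I.n}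
    (h : c.Inv (I.h i) K z₂ m₁ a₁ m₂ a₂) (hi : i ∉ c.done) (hx : 2 * I.h i ≤ I.T)
    (hl₁ : I.T < c.l₁ + I.h i) (he₁ : I.T < c.e₁ + I.h i)
    (hb : I.T < c.big c.q + I.h i)
    (hl₂ : I.T < c.l₂ + I.h i) (he₂ : I.T < c.e₂ + I.h i) :
    ∃ K', Inv { c.put i (c.L + c.r) 1 with r := c.r + 1, st₂ := 1, e₂ := I.h i, l₂ := I.h i }
      (I.h i) K' (I.h i) m₁ a₁ 1 (I.h i ^ 2) := by
  classical
  have hload : ∀ j t, (c.put i (c.L + c.r) 1).load j t =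
      c.load j t + if j = c.L + c.r ∧ 1 ≤ t ∧ t < 1 + I.h i then I.h i else 0 :=
    load_put hQ c hi (c.L + c.r) 1
  have hload' : ∀ j, j ≠ c.L + c.r → (c.put i (c.L + c.r) 1).load j = c.load j := fun j hj => by
    funext t
    rw [hload, if_neg (fun h => hj h.1), add_zero]
  have hzero : ∀ t, c.load (c.L + c.r) t = 0 := h.load_eq_zero le_rfl
  have hcol : ColumnBin I.T (I.h i) ((c.put i (c.L + c.r) 1).load (c.L + c.r)) 1 (I.h i) (I.h i)
      (I.h i) 1 1 1 (I.h i ^ 2) := by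
    refine ColumnBin.single (by omega) (fun t => ?_) fun t ht => ?_
    · rw [hload, hzero]
      split_ifs <;> omega
    · rw [hload, hzero, if_neg (by omega)]
  have hKr := h.K_le
  have hqL := h.q_le
  obtain ⟨K', hK', hK3, hLK, hLr, hK⟩ : ∃ K', K' ≤ c.r + 1 ∧ (K' = c.r + 1 ↔ I.T < 3 * I.h i) ∧
      c.L + K' ≤ I.OPT ∧ c.L + (c.r + 1) ≤ 2 * I.OPT ∧
      4 * I.T ^ 2 * min K' c.r + 5 * I.T ^ 2 * (c.r - K') ≤
        4 * I.T ^ 2 * min K (c.r - 1) + 5 * I.T ^ 2 * (c.r - 1 - K) + 9 * a₂ := by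
    have harea := h.area_second hl₂ he₂
    by_cases hx3 : I.T < 3 * I.h i
    · have hOPT := h.lt_OPT_of_medium hI hQ hi hx hx3 hl₁ he₁ hb hl₂ he₂
      -- Sizes decrease, so an open bin without a large item began with an item at least as large as
      -- this medium one.
      have hK : K = c.r := by
        rcases h.second with h1 | ⟨_, _, h1, k, n, h2⟩
        · omega
        · refine h1.2 ?_
          have := h2.le_width
          have := h2.width_le
          omega
      refine ⟨c.r + 1, le_rfl, by simpa using hx3, by omega, by omega, ?_⟩
      rw [hK, Nat.sub_self] at harea
      rw [hK, min_eq_right (Nat.le_succ _), Nat.sub_eq_zero_of_le (Nat.le_succ _)]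
      exact harea
    · have := h.L_add_r_lt hI hQ hi (not_lt.1 hx3) hl₁ he₁ hb hl₂ he₂
      refine ⟨K, by omega, by omega, h.L_add_K_le, by omega, ?_⟩
      rwa [min_eq_left hKr]
  have hm₂ : c.r = 0 ∨ 4 ≤ m₂ := by
    rcases h.second with h1 | ⟨_, h1, _, k, n, h2⟩
    · exact Or.inl h1.1
    · exact Or.inr (h2.four_le (by omega) hl₂ he₂)
  refine ⟨K',
    { le_done := fun k hk => ?_
      le_rest := fun k hk => h.le_rest k fun hk' => hk (Finset.mem_insert_of_mem hk')
      valid := fun k hk => ?_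
      load_le := fun j t => ?_
      large_phase := fun h => absurd h (by omega)
      q_le := h.q_le
      big_zero := h.big_zero
      big_anti := h.big_anti
      owner := fun j hj => ?_
      fresh := fun j hj t => ?_
      K_le := hK'
      L_add_K_le := hLK
      L_add_r_le := hLr
      first := h.first.imp_right fun ⟨h1, k, n, h2⟩ => ⟨h1, k, n, ?_⟩
      second := Or.inr ⟨Nat.succ_pos _, hx, hK3, 1, 1, hcol⟩
      count := ?_
      area := ?_ }⟩
  · rcases Finset.mem_insert.1 hk with rfl | hk
    · exact le_rfl
    · exact h.le_done k hk
  · by_cases hki : k = i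
    · subst hki
      simp only [put, Function.update_self]
      omega
    · simp only [put, Function.update_of_ne hki]
      have := h.valid k ((Finset.mem_insert.1 hk).resolve_left hki)
      omega
  · show (c.put i (c.L + c.r) 1).load j t ≤ I.T
    by_cases hj : j = c.L + c.r
    · subst hj
      exact hcol.load_le t
    · rw [hload' j hj]
      exact h.load_le j t
  · obtain ⟨k, hk, h1⟩ := h.owner j hj
    have hki : k ≠ i := fun h => hi (h ▸ hk)
    exact ⟨k, Finset.mem_insert_of_mem hk, by simpa only [put, Function.update_of_ne hki] using h1⟩
  · show (c.put i (c.L + c.r) 1).load j t ≤ _ ∧ (_ → (c.put i (c.L + c.r) 1).load j t = 0)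
    rw [hload' j (by dsimp only [put] at hj; omega)]
    exact h.fresh j hj t
  · have := h.count
    simp only [put, Finset.card_insert_of_notMem hi]
    omega
  · have := h.area
    simp only [put, Finset.sum_insert hi, Nat.add_sub_cancel]
    omega
  · show ColumnBin _ _ ((c.put i (c.L + c.r) 1).load c.q) _ _ _ _ _ _ _ _
    rw [hload' _ (by omega)]
    exact h2

/-! ### Correctness of the packing algorithm. -/

/-- The invariant holds for some bookkeeping data. -/
def Good (c : Config I) (x : ℕ) : Prop :=
  ∃ K z₂ m₁ a₁ m₂ a₂, c.Inv x K z₂ m₁ a₁ m₂ a₂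

theorem good_init (hI : I.Fits) (hQ : I.IsSquareSquare) : (init I).Good I.T :=
  ⟨_, _, _, _, _, _, inv_init hI hQ⟩

theorem Good.step (hI : I.Fits) (hQ : I.IsSquareSquare) {c : Config I} {x : ℕ} (h : c.Good x)
    {i : Fin I.n} (hi : i ∉ c.done) (hmax : ∀ k ∉ c.done, I.h k ≤ I.h i) :
    (c.step i).Good (I.h i) := by
  obtain ⟨K, z₂, m₁, a₁, m₂, a₂, h0⟩ := h
  have h := h0.mono hi hmax
  unfold Config.step
  split_ifs with h1 h2 h3 h4 h5 h6
  · exact ⟨_, _, _, _, _, _, h.put_large hI hQ hi (by omega)⟩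
  · obtain ⟨hq, k, n, hb⟩ : c.q < c.L ∧ ∃ k n, ColumnBin I.T (I.h i) (c.load c.q) c.st₁ c.e₁ c.l₁
        (c.big (c.q + 1)) k n m₁ a₁ := h.first.resolve_left fun h' => by omega
    have hw := hb.le_width
    have he := hb.e_le
    exact ⟨_, _, _, _, _, _, h.put_first hQ hi (by omega) hq hb.st_pos (by omega)
      ⟨_, _, hb.stack le_rfl h2 fun t => by simp [load_put hQ c hi]⟩⟩
  · obtain ⟨hq, k, n, hb⟩ : c.q < c.L ∧ ∃ k n, ColumnBin I.T (I.h i) (c.load c.q) c.st₁ c.e₁ c.l₁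
        (c.big (c.q + 1)) k n m₁ a₁ := h.first.resolve_left fun h' => by omega
    exact ⟨_, _, _, _, _, _, h.put_first hQ hi (by omega) hq (Nat.le_add_left _ _) (by omega)
      ⟨_, _, hb.column le_rfl (not_le.1 h2) h3 fun t => by simp [load_put hQ c hi]⟩⟩
  · obtain ⟨hq, h'⟩ := h.next_large (by omega) (not_le.1 h2) (not_le.1 h3) h4
    have hqL := h.q_le
    obtain ⟨-, k, n, hb⟩ := h'.first.resolve_left fun h' => by
      have := h'.1
      dsimp only at this
      omega
    have hput := h'.put_first hQ (a := 1) hi (by omega) (by dsimp only; omega) le_rfl (by omega)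
      ⟨_, _, hb.stack le_rfl h4 fun t => by
        refine (load_put hQ _ ?_ _ _ _ _).trans ?_
        · exact hi
        · simp⟩
    exact ⟨_, _, _, _, _, _, hput⟩
  · obtain ⟨hr, hz, hK, k, n, hb⟩ := h.second.resolve_left fun h' => by omega
    have hw := hb.le_width
    have he := hb.e_le
    exact ⟨_, _, _, _, _, _, h.put_second hQ hi (by omega) hr hb.st_pos (by omega) hz hK
      ⟨_, _, hb.stack le_rfl h5 fun t => by simp [load_put hQ c hi]⟩⟩
  · obtain ⟨hr, hz, hK, k, n, hb⟩ := h.second.resolve_left fun h' => by omega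
    exact ⟨_, _, _, _, _, _, h.put_second hQ hi (by omega) hr (Nat.le_add_left _ _) (by omega) hz hK
      ⟨_, _, hb.column le_rfl (not_le.1 h5) h6 fun t => by simp [load_put hQ c hi]⟩⟩
  · obtain ⟨K', h'⟩ := h.put_new hI hQ hi (by omega) (not_le.1 h2) (not_le.1 h3) (not_le.1 h4)
      (not_le.1 h5) (not_le.1 h6)
    exact ⟨_, _, _, _, _, _, h'⟩

/-- When everything is packed, the packing is a solution with at most `2 * OPT` bins. -/
theorem Good.isSolution (hQ : I.IsSquareSquare) {c : Config I} {x : ℕ} (h : c.Good x)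
    (hd : c.done = Finset.univ) :
    I.IsSolution (c.L + c.r) c.bin c.start ∧ c.L + c.r ≤ 2 * I.OPT := by
  obtain ⟨K, z₂, m₁, a₁, m₂, a₂, h⟩ := h
  have hv : ∀ i, _ := fun i => h.valid i (hd ▸ Finset.mem_univ i)
  refine ⟨⟨fun i => (hv i).1, fun j _ => ⟨fun i _ => ?_, fun t _ => ?_⟩⟩, h.L_add_r_le⟩
  · rw [← hQ.2]
    exact (hv i).2
  · have := h.load_le j t
    rw [hQ.1] at this
    unfold load at this
    rwa [hd] at this

end Config

end DemandInstance

/-! ### Polynomial bounds for the random access machine -/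

namespace RAM

theorem State.setReg_reg (s : State) (x v y : ℕ) :
    (s.setReg x v).reg y = if y = x then v else s.reg y := by
  simp [State.setReg, Function.update_apply]

theorem State.setReg_arr (s : State) (x v : ℕ) : (s.setReg x v).arr = s.arr := rfl

theorem State.setArr_reg (s : State) (a i v : ℕ) : (s.setArr a i v).reg = s.reg := rfl

theorem State.setArr_arr (s : State) (a i v b k : ℕ) :
    (s.setArr a i v).arr b k = if b = a ∧ k = i then v else s.arr b k := by
  by_cases h : b = a
  · subst h
    simp [State.setArr, Function.update_apply]
  · simp [State.setArr, h]

/-! ### From elementary steps to logarithmic cost. -/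

/-- `Steps p s s' N`: started in `s`, program `p` halts in `s'` after `N` elementary steps. -/
inductive Steps : Prog → State → State → ℕ → Prop
  | skip (s : State) : Steps .skip s s 1
  | assign (s : State) (x : ℕ) (e : Expr) : Steps (.assign x e) s (s.setReg x (e.val s)) 1
  | store (s : State) (a : ℕ) (i e : Expr) :
      Steps (.store a i e) s (s.setArr a (i.val s) (e.val s)) 1
  | seq {p q : Prog} {s s₁ s₂ : State} {N₁ N₂ : ℕ} :
      Steps p s s₁ N₁ → Steps q s₁ s₂ N₂ → Steps (.seq p q) s s₂ (N₁ + N₂)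
  | ite_true {e : Expr} {p q : Prog} {s s' : State} {N : ℕ} :
      e.val s ≠ 0 → Steps p s s' N → Steps (.ite e p q) s s' (1 + N)
  | ite_false {e : Expr} {p q : Prog} {s s' : State} {N : ℕ} :
      e.val s = 0 → Steps q s s' N → Steps (.ite e p q) s s' (1 + N)
  | loop_done {e : Expr} {p : Prog} {s : State} :
      e.val s = 0 → Steps (.loop e p) s s 1
  | loop_step {e : Expr} {p : Prog} {s s₁ s₂ : State} {N₁ N₂ : ℕ} :
      e.val s ≠ 0 → Steps p s s₁ N₁ → Steps (.loop e p) s₁ s₂ N₂ →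
        Steps (.loop e p) s s₂ (1 + N₁ + N₂)

/-- Size of an expression, with constants in unary. -/
def Expr.weight : Expr → ℕ
  | .const v => v + 1
  | .var _ => 1
  | .get _ i => i.weight + 1
  | .add e₁ e₂ => e₁.weight + e₂.weight + 1
  | .sub e₁ e₂ => e₁.weight + e₂.weight + 1

/-- Size of a program, with constants in unary. -/
def Prog.weight : Prog → ℕ
  | .skip => 1
  | .assign _ e => e.weight + 1
  | .store _ i e => i.weight + e.weight + 1
  | .seq p q => p.weight + q.weight + 1
  | .ite e p q => e.weight + p.weight + q.weight + 1
  | .loop e p => e.weight + p.weight + 1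

/-- All numbers in memory have at most `k` bits. -/
def State.Bits (k : ℕ) (s : State) : Prop :=
  (∀ x, s.reg x < 2 ^ k) ∧ ∀ a i, s.arr a i < 2 ^ k

theorem len_le {v m : ℕ} (h : v < 2 ^ m) : len v ≤ m + 1 :=
  Nat.succ_le_succ (Nat.size_le.2 h)

theorem State.Bits.mono {k k' : ℕ} {s : State} (h : s.Bits k) (hk : k ≤ k') : s.Bits k' :=
  have h2 : 2 ^ k ≤ 2 ^ k' := Nat.pow_le_pow_right two_pos hk
  ⟨fun x => (h.1 x).trans_le h2, fun a i => (h.2 a i).trans_le h2⟩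

theorem State.Bits.setReg {k : ℕ} {s : State} (h : s.Bits k) {x v : ℕ} (hv : v < 2 ^ k) :
    (s.setReg x v).Bits k := by
  refine ⟨fun y => ?_, h.2⟩
  rw [State.setReg_reg]
  split_ifs
  exacts [hv, h.1 y]

theorem State.Bits.setArr {k : ℕ} {s : State} (h : s.Bits k) {a i v : ℕ} (hv : v < 2 ^ k) :
    (s.setArr a i v).Bits k := by
  refine ⟨h.1, fun b j => ?_⟩
  rw [State.setArr_arr]
  split_ifs
  exacts [hv, h.2 b j]

/-- An addition costs at most one extra bit, and a constant `v` is below `2 ^ v`, which is why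
weights count constants in unary. -/
theorem Expr.val_lt {k : ℕ} {s : State} (h : s.Bits k) : ∀ e : Expr, e.val s < 2 ^ (k + e.weight)
  | .const v =>
    v.lt_two_pow_self.trans_le (Nat.pow_le_pow_right two_pos (by simp only [weight]; omega))
  | .var x => (h.1 x).trans_le (Nat.pow_le_pow_right two_pos (by omega))
  | .get a i => (h.2 a _).trans_le (Nat.pow_le_pow_right two_pos (by omega))
  | .add e₁ e₂ => by
    have h1 := e₁.val_lt h
    have h2 := e₂.val_lt h
    have h3 : 2 ^ (k + e₁.weight) ≤ 2 ^ (k + e₁.weight + e₂.weight) :=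
      Nat.pow_le_pow_right two_pos (by omega)
    have h4 : 2 ^ (k + e₂.weight) ≤ 2 ^ (k + e₁.weight + e₂.weight) :=
      Nat.pow_le_pow_right two_pos (by omega)
    have h5 : 2 ^ (k + (e₁.weight + e₂.weight + 1)) = 2 * 2 ^ (k + e₁.weight + e₂.weight) := by
      rw [← pow_succ']
      congr 1
      omega
    simp only [val, weight]
    omega
  | .sub e₁ e₂ => by
    have h1 := e₁.val_lt h
    have h3 : 2 ^ (k + e₁.weight) ≤ 2 ^ (k + (e₁.weight + e₂.weight + 1)) :=
      Nat.pow_le_pow_right two_pos (by omega)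
    simp only [val, weight]
    omega

theorem Expr.cost_le {k : ℕ} {s : State} (h : s.Bits k) {R : ℕ} :
    ∀ e : Expr, k + e.weight ≤ R → e.cost s ≤ e.weight * (R + 1)
  | .const v, hR => by
    have := len_le ((Expr.const v).val_lt h)
    simp only [cost, val, weight] at *
    nlinarith
  | .var x, hR => by
    have := len_le (h.1 x)
    simp only [cost, weight] at *
    omega
  | .get a i, hR => by
    have h1 := len_le (h.2 a (i.val s))
    simp only [cost, weight] at *
    have h2 := i.cost_le h (R := R) (by omega)
    rw [Nat.add_mul]
    omega
  | .add e₁ e₂, hR => by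
    have h0 := len_le ((Expr.add e₁ e₂).val_lt h)
    simp only [cost, val, weight] at *
    have h1 := e₁.cost_le h (R := R) (by omega)
    have h2 := e₂.cost_le h (R := R) (by omega)
    rw [Nat.add_mul, Nat.add_mul]
    omega
  | .sub e₁ e₂, hR => by
    have h0 := len_le ((Expr.sub e₁ e₂).val_lt h)
    simp only [cost, val, weight] at *
    have h1 := e₁.cost_le h (R := R) (by omega)
    have h2 := e₂.cost_le h (R := R) (by omega)
    rw [Nat.add_mul, Nat.add_mul]
    omega

theorem step_cost_le {w W R t : ℕ} (hw : w + 1 ≤ W) (ht : t ≤ w * (R + 1)) :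
    t + 1 ≤ W * (R + 1) := by
  have : (w + 1) * (R + 1) ≤ W * (R + 1) := Nat.mul_le_mul_right _ hw
  rw [Nat.add_mul] at this
  omega

/-- An elementary step lengthens the numbers in memory by at most a constant number of bits. So
the running time is polynomial in the number of steps. -/
theorem Steps.exec {p : Prog} {s s' : State} {N : ℕ} (h : Steps p s s' N) {W : ℕ}
    (hW : p.weight ≤ W) :
    ∀ {k R : ℕ}, s.Bits k → k + N * W ≤ R →
      s'.Bits (k + N * W) ∧ ∃ t, Exec p s s' t ∧ t ≤ N * (W * (R + 1)) := by
  induction h with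
  | skip s =>
    intro k R hk hR
    simp only [Prog.weight] at hW
    exact ⟨hk.mono (by omega), 1, .skip s, by rw [one_mul]; exact Nat.mul_pos hW (Nat.succ_pos _)⟩
  | assign s x e =>
    intro k R hk hR
    simp only [Prog.weight] at hW
    refine ⟨(hk.mono (by omega)).setReg ((e.val_lt hk).trans_le
      (Nat.pow_le_pow_right two_pos (by omega))), _, .assign s x e, ?_⟩
    rw [one_mul]
    exact step_cost_le hW (e.cost_le hk (by omega))
  | store s a i e =>
    intro k R hk hR
    simp only [Prog.weight] at hW
    refine ⟨(hk.mono (by omega)).setArr ((e.val_lt hk).trans_le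
      (Nat.pow_le_pow_right two_pos (by omega))), _, .store s a i e, ?_⟩
    rw [one_mul]
    refine step_cost_le hW ?_
    rw [Nat.add_mul]
    exact Nat.add_le_add (i.cost_le hk (by omega)) (e.cost_le hk (by omega))
  -- The second part starts with numbers that are longer by `N₁ * W` bits. The cap `R` covers the
  -- whole run, so both parts pay the same price per step and the times add up.
  | seq _ _ ih₁ ih₂ =>
    intro k R hk hR
    simp only [Prog.weight] at hW
    rw [Nat.add_mul] at hR
    obtain ⟨hb₁, t₁, he₁, ht₁⟩ := ih₁ (by omega) hk (R := R) (by omega)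
    obtain ⟨hb₂, t₂, he₂, ht₂⟩ := ih₂ (by omega) hb₁ (R := R) (by omega)
    refine ⟨hb₂.mono (by rw [Nat.add_mul]; omega), _, he₁.seq he₂, ?_⟩
    rw [Nat.add_mul]
    omega
  | @ite_true e p q s s' N he _ ih =>
    intro k R hk hR
    simp only [Prog.weight] at hW
    rw [Nat.add_mul] at hR
    obtain ⟨hb, t, hex, ht⟩ := ih (by omega) hk (R := R) (by omega)
    refine ⟨hb.mono (by rw [Nat.add_mul]; omega), _, .ite_true he hex, ?_⟩
    have := step_cost_le (W := W) (by omega) (e.cost_le hk (R := R) (by omega))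
    rw [Nat.add_mul]
    omega
  | @ite_false e p q s s' N he _ ih =>
    intro k R hk hR
    simp only [Prog.weight] at hW
    rw [Nat.add_mul] at hR
    obtain ⟨hb, t, hex, ht⟩ := ih (by omega) hk (R := R) (by omega)
    refine ⟨hb.mono (by rw [Nat.add_mul]; omega), _, .ite_false he hex, ?_⟩
    have := step_cost_le (W := W) (by omega) (e.cost_le hk (R := R) (by omega))
    rw [Nat.add_mul]
    omega
  | @loop_done e p s he =>
    intro k R hk hR
    simp only [Prog.weight] at hW
    refine ⟨hk.mono (by omega), _, .loop_done he, ?_⟩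
    rw [one_mul]
    exact step_cost_le (by omega) (e.cost_le hk (by omega))
  | @loop_step e p s s₁ s₂ N₁ N₂ he _ _ ih₁ ih₂ =>
    intro k R hk hR
    have hW' := hW
    simp only [Prog.weight] at hW'
    rw [Nat.add_mul, Nat.add_mul] at hR
    obtain ⟨hb₁, t₁, he₁, ht₁⟩ := ih₁ (by omega) hk (R := R) (by omega)
    obtain ⟨hb₂, t₂, he₂, ht₂⟩ := ih₂ hW hb₁ (R := R) (by omega)
    refine ⟨hb₂.mono (by rw [Nat.add_mul, Nat.add_mul]; omega), _, .loop_step he he₁ he₂, ?_⟩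
    have := step_cost_le (W := W) (by omega) (e.cost_le hk (R := R) (by omega))
    rw [Nat.add_mul, Nat.add_mul]
    omega

/-- Started in `s`, program `p` halts after at most `B` steps in a state satisfying `Q`. -/
def Runs (p : Prog) (s : State) (B : ℕ) (Q : State → Prop) : Prop :=
  ∃ s' N, Steps p s s' N ∧ N ≤ B ∧ Q s'

theorem Runs.seq {p q : Prog} {s : State} {B₁ B₂ : ℕ} {Q R : State → Prop} (h : Runs p s B₁ Q)
    (h' : ∀ s, Q s → Runs q s B₂ R) : Runs (.seq p q) s (B₁ + B₂) R := by
  obtain ⟨s₁, N₁, h1, h2, h3⟩ := h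
  obtain ⟨s₂, N₂, h4, h5, h6⟩ := h' s₁ h3
  exact ⟨s₂, _, h1.seq h4, Nat.add_le_add h2 h5, h6⟩

/-- A loop whose body is executed `n` times. -/
theorem Runs.loop {e : Expr} {p : Prog} {B n : ℕ} {Q : ℕ → State → Prop}
    (hstep : ∀ k s, k < n → Q k s → e.val s ≠ 0 ∧ Runs p s B (Q (k + 1)))
    (hdone : ∀ s, Q n s → e.val s = 0) {s : State} (h : Q 0 s) :
    Runs (.loop e p) s (n * (B + 1) + 1) (Q n) := by
  suffices H : ∀ m k s, k + m = n → Q k s → Runs (.loop e p) s (m * (B + 1) + 1) (Q n) from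
    H n 0 s (zero_add n) h
  intro m
  induction m with
  | zero =>
    intro k s hk hQ
    obtain rfl : k = n := hk
    exact ⟨s, 1, .loop_done (hdone s hQ), by omega, hQ⟩
  | succ m ih =>
    intro k s hk hQ
    obtain ⟨he, s₁, N₁, h1, h2, h3⟩ := hstep k s (by omega) hQ
    obtain ⟨s₂, N₂, h4, h5, h6⟩ := ih (k + 1) s₁ (by omega) h3
    exact ⟨s₂, _, .loop_step he h1 h4, by rw [Nat.succ_mul]; omega, h6⟩

/-- Programs without loops. -/
def Prog.LoopFree : Prog → Prop
  | .skip => True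
  | .assign _ _ => True
  | .store _ _ _ => True
  | .seq p q => p.LoopFree ∧ q.LoopFree
  | .ite _ p q => p.LoopFree ∧ q.LoopFree
  | .loop _ _ => False

/-- Final state of a program without loops. -/
def Prog.eval : Prog → State → State
  | .skip, s => s
  | .assign x e, s => s.setReg x (e.val s)
  | .store a i e, s => s.setArr a (i.val s) (e.val s)
  | .seq p q, s => q.eval (p.eval s)
  | .ite e p q, s => if e.val s = 0 then q.eval s else p.eval s
  | .loop _ _, s => s

theorem Prog.LoopFree.steps : ∀ {p : Prog}, p.LoopFree → ∀ s : State,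
    ∃ N, Steps p s (p.eval s) N ∧ N ≤ p.weight
  | .skip, _, s => ⟨1, .skip s, le_rfl⟩
  | .assign x e, _, s => ⟨1, .assign s x e, Nat.le_add_left _ _⟩
  | .store a i e, _, s => ⟨1, .store s a i e, Nat.le_add_left _ _⟩
  | .seq p q, h, s => by
    obtain ⟨N₁, h1, h2⟩ := h.1.steps s
    obtain ⟨N₂, h3, h4⟩ := h.2.steps (p.eval s)
    exact ⟨_, h1.seq h3, by simp only [weight]; omega⟩
  | .ite e p q, h, s => by
    by_cases he : e.val s = 0
    · obtain ⟨N, h1, h2⟩ := h.2.steps s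
      exact ⟨_, by simpa only [eval, he, if_true] using Steps.ite_false he h1,
        by simp only [weight]; omega⟩
    · obtain ⟨N, h1, h2⟩ := h.1.steps s
      exact ⟨_, by simpa only [eval, he, if_false] using Steps.ite_true he h1,
        by simp only [weight]; omega⟩

theorem Prog.LoopFree.runs {p : Prog} (hp : p.LoopFree) {s : State} {Q : State → Prop}
    (h : Q (p.eval s)) : Runs p s p.weight Q :=
  let ⟨N, h1, h2⟩ := hp.steps s
  ⟨_, N, h1, h2, h⟩

end RAM

/-! ### The program -/

namespace DemandInstance

open RAM

namespace Program

/-- Nonzero if and only if `e₁ ≤ e₂`. -/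
def leExpr (e₁ e₂ : Expr) : Expr := .sub (.add e₂ (.const 1)) e₁

/-- Put the item in register `5` into bin `j` at slot `a`. -/
def put (j a : Expr) : Prog := .seq (.store 2 (.var 5) j) (.store 3 (.var 5) a)

/-- Open a bin with a large item. -/
def large : Prog :=
  .seq (put (.var 8) (.const 1)) <|
  .seq (.store 5 (.add (.var 8) (.const 1)) (.var 7)) <|
  .seq (.assign 8 (.add (.var 8) (.const 1))) (.assign 9 (.var 8))

/-- Continue the column in the bin with a large item. -/
def stackFirst : Prog :=
  .seq (put (.var 9) (.var 10)) (.assign 12 (.add (.var 12) (.var 7)))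

/-- Open a column in the bin with a large item. -/
def columnFirst : Prog :=
  .seq (.assign 10 (.add (.var 11) (.const 1))) <|
  .seq (put (.var 9) (.var 10)) <|
  .seq (.assign 11 (.add (.var 11) (.var 7))) (.assign 12 (.var 7))

/-- Go on to the next bin with a large item. -/
def nextFirst : Prog :=
  .seq (.assign 11 (.get 5 (.var 9))) <|
  .seq (.assign 12 (.add (.var 11) (.var 7))) <|
  .seq (.assign 9 (.sub (.var 9) (.const 1))) <|
  .seq (.assign 10 (.const 1)) (put (.var 9) (.const 1))

/-- Continue the column in the bin without a large item. -/
def stackSecond : Prog :=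
  .seq (put (.sub (.add (.var 8) (.var 13)) (.const 1)) (.var 14))
    (.assign 16 (.add (.var 16) (.var 7)))

/-- Open a column in the bin without a large item. -/
def columnSecond : Prog :=
  .seq (.assign 14 (.add (.var 15) (.const 1))) <|
  .seq (put (.sub (.add (.var 8) (.var 13)) (.const 1)) (.var 14)) <|
  .seq (.assign 15 (.add (.var 15) (.var 7))) (.assign 16 (.var 7))

/-- Open a bin without a large item. -/
def nextSecond : Prog :=
  .seq (put (.add (.var 8) (.var 13)) (.const 1)) <|
  .seq (.assign 13 (.add (.var 13) (.const 1))) <|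
  .seq (.assign 14 (.const 1)) <|
  .seq (.assign 15 (.var 7)) (.assign 16 (.var 7))

/-- Pack the item in register `5`, whose size stands in register `7`. -/
def place : Prog :=
  .ite (.sub (.add (.var 7) (.var 7)) (.var 1)) large <|
  .ite (leExpr (.add (.var 12) (.var 7)) (.var 1)) stackFirst <|
  .ite (leExpr (.add (.var 11) (.var 7)) (.var 1)) columnFirst <|
  .ite (leExpr (.add (.get 5 (.var 9)) (.var 7)) (.var 1)) nextFirst <|
  .ite (leExpr (.add (.var 16) (.var 7)) (.var 1)) stackSecond <|
  .ite (leExpr (.add (.var 15) (.var 7)) (.var 1)) columnSecond nextSecond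

/-- One step in the search for the largest item that is not yet packed. -/
def searchStep : Prog :=
  .seq
    (.ite (.get 4 (.var 4)) .skip <|
      .ite (.sub (.add (.get 0 (.var 4)) (.const 1)) (.var 6))
        (.seq (.assign 5 (.var 4)) (.assign 6 (.add (.get 0 (.var 4)) (.const 1)))) .skip)
    (.assign 4 (.add (.var 4) (.const 1)))

/-- Start the search. -/
def searchInit : Prog := .seq (.assign 4 (.const 0)) (.assign 6 (.const 0))

/-- Pack the item that was found. -/
def finish : Prog :=
  .seq (.assign 7 (.sub (.var 6) (.const 1))) <|
  .seq (.store 4 (.var 5) (.const 1)) <|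
  .seq (.assign 3 (.add (.var 3) (.const 1))) place

/-- Find the largest item that is not yet packed and pack it. -/
def round : Prog :=
  .seq searchInit <| .seq (.loop (.sub (.var 0) (.var 4)) searchStep) finish

/-- Initially no bin is open. -/
def initProg : Prog :=
  .seq (.store 5 (.const 0) (.add (.var 1) (.const 1))) <|
  .seq (.assign 11 (.add (.var 1) (.const 1))) <|
  .seq (.assign 12 (.add (.var 1) (.const 1))) <|
  .seq (.assign 15 (.add (.var 1) (.const 1))) (.assign 16 (.add (.var 1) (.const 1)))

/-- The algorithm. -/
def main : Prog :=
  .seq initProg <| .seq (.loop (.sub (.var 0) (.var 3)) round) (.assign 0 (.add (.var 8) (.var 13)))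

/-! ### The program simulates the packing algorithm. -/

/-- The memory `s` represents the configuration `c`. -/
structure Rel {I : DemandInstance} (s : State) (c : Config I) : Prop where
  n : s.reg 0 = I.n
  T : s.reg 1 = I.T
  card : s.reg 3 = c.done.card
  L : s.reg 8 = c.L
  q : s.reg 9 = c.q
  st₁ : s.reg 10 = c.st₁
  e₁ : s.reg 11 = c.e₁
  l₁ : s.reg 12 = c.l₁
  r : s.reg 13 = c.r
  st₂ : s.reg 14 = c.st₂
  e₂ : s.reg 15 = c.e₂
  l₂ : s.reg 16 = c.l₂
  -- Widths and capacity are absent: for square tasks and bins they repeat the heights and `T`, and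
  -- the program never reads them.
  h : ∀ i : Fin I.n, s.arr 0 i = I.h i
  bin : ∀ i : Fin I.n, s.arr 2 i = c.bin i
  start : ∀ i : Fin I.n, s.arr 3 i = c.start i
  done : ∀ i : Fin I.n, s.arr 4 i = if i ∈ c.done then 1 else 0
  big : ∀ j, s.arr 5 j = c.big j

variable {I : DemandInstance}

theorem rel_init : Rel (initProg.eval I.input) (Config.init I) := by
  constructor <;>
    simp [initProg, Prog.eval, State.setReg_reg, State.setReg_arr, State.setArr_reg,
      State.setArr_arr, Expr.val, input, Config.init, Function.update_apply]

/-- Registers `4`, `5` and `6` do not matter. -/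
theorem Rel.congr {s s' : State} {c : Config I} (h : Rel s c) (harr : s'.arr = s.arr)
    (hreg : ∀ x, x ≠ 4 → x ≠ 5 → x ≠ 6 → s'.reg x = s.reg x) : Rel s' c := by
  constructor <;>
    first
    | rw [hreg _ (by decide) (by decide) (by decide)]; first
      | exact h.n | exact h.T | exact h.card | exact h.L | exact h.q | exact h.st₁ | exact h.e₁
      | exact h.l₁ | exact h.r | exact h.st₂ | exact h.e₂ | exact h.l₂
    | rw [harr]; first
      | exact h.h | exact h.bin | exact h.start | exact h.done | exact h.big

/-- Invariant of the search. -/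
structure Search (c : Config I) (k : ℕ) (s : State) : Prop where
  rel : Rel s c
  counter : s.reg 4 = k
  -- Register 6 stores the best size plus one, so that 0 means "nothing found" even if there are
  -- items of size 0.
  found : (s.reg 6 = 0 ∧ ∀ i : Fin I.n, (i : ℕ) < k → i ∈ c.done) ∨
    ∃ i : Fin I.n, i ∉ c.done ∧ s.reg 5 = i ∧ s.reg 6 = I.h i + 1 ∧
      ∀ j : Fin I.n, (j : ℕ) < k → j ∉ c.done → I.h j ≤ I.h i

theorem search_init {s : State} {c : Config I} (h : Rel s c) :
    Search c 0 (searchInit.eval s) where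
  rel := h.congr rfl fun x h4 _ h6 => by
    simp [searchInit, Prog.eval, State.setReg_reg, h4, h6]
  counter := by simp [searchInit, Prog.eval, State.setReg_reg, Expr.val]
  found := Or.inl ⟨by simp [searchInit, Prog.eval, State.setReg_reg, Expr.val], by simp⟩

theorem search_step {s : State} {c : Config I} {k : ℕ} (hk : k < I.n) (h : Search c k s) :
    Search c (k + 1) (searchStep.eval s) := by
  have hdone := h.rel.done ⟨k, hk⟩
  have hh := h.rel.h ⟨k, hk⟩
  have hc := h.counter
  dsimp only at hdone hh
  by_cases hd : (⟨k, hk⟩ : Fin I.n) ∈ c.done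
  · rw [if_pos hd] at hdone
    have heval : searchStep.eval s = s.setReg 4 (k + 1) := by
      simp [searchStep, Prog.eval, Expr.val, hc, hdone]
    rw [heval]
    refine ⟨h.rel.congr rfl fun x h4 _ _ => by simp [State.setReg_reg, h4],
      by simp [State.setReg_reg], ?_⟩
    simp only [State.setReg_reg]
    refine h.found.imp (fun ⟨h1, h2⟩ => ⟨h1, fun i hi => ?_⟩)
      fun ⟨i, h1, h2, h3, h4⟩ => ⟨i, h1, h2, h3, fun j hj hjd => ?_⟩
    · rcases Nat.lt_succ_iff_lt_or_eq.1 hi with hi | rfl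
      exacts [h2 i hi, hd]
    · rcases Nat.lt_succ_iff_lt_or_eq.1 hj with hj | rfl
      exacts [h4 j hj hjd, absurd hd hjd]
  · rw [if_neg hd] at hdone
    by_cases hlt : s.reg 6 < I.h ⟨k, hk⟩ + 1
    · have hne : I.h ⟨k, hk⟩ + 1 - s.reg 6 ≠ 0 := by omega
      have heval : searchStep.eval s =
          ((s.setReg 5 k).setReg 6 (I.h ⟨k, hk⟩ + 1)).setReg 4 (k + 1) := by
        simp [searchStep, Prog.eval, Expr.val, hc, hdone, hh, hne, State.setReg_reg,
          State.setReg_arr]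
      rw [heval]
      refine ⟨h.rel.congr rfl fun x h4 h5 h6 => by simp [State.setReg_reg, h4, h5, h6],
        by simp [State.setReg_reg], Or.inr ⟨⟨k, hk⟩, hd, by simp [State.setReg_reg],
          by simp [State.setReg_reg], fun j hj hjd => ?_⟩⟩
      rcases Nat.lt_succ_iff_lt_or_eq.1 hj with hj | rfl
      · rcases h.found with ⟨h1, h2⟩ | ⟨i, h1, h2, h3, h4⟩
        · exact absurd (h2 j hj) hjd
        · have := h4 j hj hjd
          omega
      · exact le_rfl
    · have hne : I.h ⟨k, hk⟩ + 1 - s.reg 6 = 0 := by omega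
      have heval : searchStep.eval s = s.setReg 4 (k + 1) := by
        simp [searchStep, Prog.eval, Expr.val, hc, hdone, hh, hne]
      rw [heval]
      refine ⟨h.rel.congr rfl fun x h4 _ _ => by simp [State.setReg_reg, h4],
        by simp [State.setReg_reg], ?_⟩
      simp only [State.setReg_reg]
      rcases h.found with ⟨h1, h2⟩ | ⟨i, h1, h2, h3, h4⟩
      · omega
      · refine Or.inr ⟨i, h1, h2, h3, fun j hj hjd => ?_⟩
        rcases Nat.lt_succ_iff_lt_or_eq.1 hj with hj | rfl
        · exact h4 j hj hjd
        · have : I.h j + 1 ≤ s.reg 6 := not_lt.1 hlt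
          omega

/-- The hypothesis has `i` already in `done`, since `finish` marks and counts the item before
`place` runs. -/
theorem place_rel {s : State} {c : Config I} {i : Fin I.n}
    (h : Rel s { c with done := insert i c.done }) (h5 : s.reg 5 = i) (h7 : s.reg 7 = I.h i) :
    Rel (place.eval s) (c.step i) := by
  have hlt : ∀ a b : ℕ, a - b = 0 ↔ ¬ b < a := fun a b => by omega
  simp only [place, Prog.eval, leExpr, Expr.val, hlt, h7, h.T, h.e₁, h.l₁, h.e₂, h.l₂, h.q,
    h.big, Nat.lt_add_one_iff, ite_not]
  unfold Config.step
  split_ifs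
  all_goals
    constructor
    all_goals
      intros
      simp [large, stackFirst, columnFirst, nextFirst, stackSecond, columnSecond, nextSecond, put,
        Config.put, Prog.eval, Expr.val, State.setReg_reg, State.setReg_arr, State.setArr_reg,
        State.setArr_arr, Function.update_apply, Fin.ext_iff, h5, h7, h.n, h.T, h.card, h.L, h.q,
        h.st₁, h.e₁, h.l₁, h.r, h.st₂, h.e₂, h.l₂, h.h, h.bin, h.start, h.done, h.big]

theorem finish_rel {s : State} {c : Config I} (h : Rel s c) {i : Fin I.n} (hi : i ∉ c.done)
    (h5 : s.reg 5 = i) (h6 : s.reg 6 = I.h i + 1) : Rel (finish.eval s) (c.step i) := by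
  simp only [finish, Prog.eval]
  refine place_rel ?_ (by simp [State.setReg_reg, State.setArr_reg, h5])
    (by simp [State.setReg_reg, State.setArr_reg, Expr.val, h6])
  constructor
  case done =>
    intro k
    by_cases hk : k = i <;>
      simp [State.setReg_arr, State.setArr_arr, State.setReg_reg, Expr.val, h5, h.done, hk,
        Fin.val_inj]
  all_goals
    intros
    simp [State.setReg_arr, State.setArr_arr, State.setReg_reg, State.setArr_reg, Expr.val,
      Finset.card_insert_of_notMem hi, h.n, h.T, h.card, h.L, h.q,
      h.st₁, h.e₁, h.l₁, h.r, h.st₂, h.e₂, h.l₂, h.h, h.bin, h.start, h.big]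

theorem round_runs (hI : I.Fits) (hQ : I.IsSquareSquare) {s : State} {c : Config I} {x : ℕ}
    (h : Rel s c) (hg : c.Good x) (hc : c.done.card < I.n) :
    Runs round s (searchInit.weight + ((I.n * (searchStep.weight + 1) + 1) + finish.weight))
      fun s' => ∃ (c' : Config I) (x' : ℕ), Rel s' c' ∧ c'.Good x' ∧
        c'.done.card = c.done.card + 1 := by
  refine Runs.seq (Q := Search c 0)
    (Prog.LoopFree.runs (by simp [searchInit, Prog.LoopFree]) (search_init h)) fun s₁ h₁ => ?_
  refine Runs.seq (Runs.loop (Q := Search c) (fun k s₂ hk h₂ => ⟨?_, ?_⟩) (fun s₂ h₂ => ?_) h₁)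
    fun s₃ h₃ => ?_
  · have := h₂.counter
    have := h₂.rel.n
    simp only [Expr.val]
    omega
  · exact Prog.LoopFree.runs (by simp [searchStep, Prog.LoopFree]) (search_step hk h₂)
  · have := h₂.counter
    have := h₂.rel.n
    simp only [Expr.val]
    omega
  · refine Prog.LoopFree.runs (by simp [finish, place, large, stackFirst, columnFirst, nextFirst,
      stackSecond, columnSecond, nextSecond, put, Prog.LoopFree]) ?_
    obtain ⟨i, hi, h5, h6, hmax⟩ := h₃.found.resolve_left fun ⟨_, h'⟩ => by
      have : c.done = Finset.univ := Finset.eq_univ_of_forall fun i => h' i i.2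
      rw [this, Finset.card_univ, Fintype.card_fin] at hc
      exact lt_irrefl _ hc
    refine ⟨c.step i, _, finish_rel h₃.rel hi h5 h6,
      hg.step hI hQ hi fun k hk => hmax k k.2 hk, ?_⟩
    have hdone : (c.step i).done = insert i c.done := by
      unfold Config.step
      split_ifs <;> rfl
    rw [hdone, Finset.card_insert_of_notMem hi]

/-! ### Step count and polynomial time bound. -/

/-- Bound on the number of steps of the algorithm for `n` items. -/
def stepBound (n : ℕ) : ℕ :=
  initProg.weight +
    (n * (searchInit.weight + ((n * (searchStep.weight + 1) + 1) + finish.weight) + 1) + 1 + 4)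

theorem main_runs (hI : I.Fits) (hQ : I.IsSquareSquare) :
    Runs main I.input (stepBound I.n) fun s =>
      I.IsSolution (s.reg 0) (fun i => s.arr 2 i) (fun i => s.arr 3 i) ∧
        s.reg 0 ≤ 2 * I.OPT := by
  let Q : ℕ → State → Prop := fun k s =>
    ∃ (c : Config I) (x : ℕ), Rel s c ∧ c.Good x ∧ c.done.card = k
  refine Runs.seq (Q := Q 0) (Prog.LoopFree.runs (by simp [initProg, Prog.LoopFree])
    ⟨Config.init I, _, rel_init, Config.good_init hI hQ, rfl⟩) fun s₁ h₁ => ?_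
  refine Runs.seq (Runs.loop (Q := Q) (fun k s₂ hk h₂ => ?_) (fun s₂ h₂ => ?_) h₁)
    fun s₃ h₃ => ?_
  · obtain ⟨c, x, hr, hg, rfl⟩ := h₂
    refine ⟨?_, round_runs hI hQ hr hg hk⟩
    have := hr.card
    have := hr.n
    simp only [Expr.val]
    omega
  · obtain ⟨c, x, hr, hg, hc⟩ := h₂
    have := hr.card
    have := hr.n
    simp only [Expr.val]
    omega
  · obtain ⟨c, x, hr, hg, hc⟩ := h₃
    refine Prog.LoopFree.runs (p := .assign 0 (.add (.var 8) (.var 13))) trivial ?_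
    have hd : c.done = Finset.univ := by
      rw [← Finset.card_eq_iff_eq_univ, hc, Fintype.card_fin]
    have hbin : (fun i : Fin I.n => s₃.arr 2 i) = c.bin := funext hr.bin
    have hstart : (fun i : Fin I.n => s₃.arr 3 i) = c.start := funext hr.start
    have := hg.isSolution hQ hd
    simpa only [Prog.eval, State.setReg_reg, State.setReg_arr, Expr.val, hr.L, hr.r, hbin, hstart,
      if_true] using this

theorem n_le_size (I : DemandInstance) : I.n ≤ I.size := by
  have : Finset.univ.card • 1 ≤ ∑ i : Fin I.n, (RAM.len (I.h i) + RAM.len (I.w i)) :=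
    Finset.card_nsmul_le_sum _ _ _ fun i _ => by simp only [RAM.len]; omega
  simp only [Finset.card_univ, Fintype.card_fin, smul_eq_mul, mul_one] at this
  unfold size
  omega

theorem input_bits (I : DemandInstance) : I.input.Bits I.size := by
  have hlen : ∀ v : ℕ, RAM.len v ≤ I.size → v < 2 ^ I.size := fun v hv =>
    Nat.size_le.1 ((Nat.le_succ _).trans hv)
  have hsum : ∀ i, RAM.len (I.h i) + RAM.len (I.w i) ≤ I.size := fun i =>
    (Finset.single_le_sum (f := fun i => RAM.len (I.h i) + RAM.len (I.w i))
      (fun _ _ => Nat.zero_le _) (Finset.mem_univ i)).trans (Nat.le_add_left _ _)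
  have h0 : 0 < 2 ^ I.size := by positivity
  refine ⟨fun x => ?_, fun a i => ?_⟩
  · simp only [input]
    split_ifs
    · exact (n_le_size I).trans_lt Nat.lt_two_pow_self
    · exact hlen _ (by unfold size; omega)
    · exact hlen _ (by unfold size; omega)
    · exact h0
  · simp only [input]
    split_ifs with hi
    · exact hlen _ ((Nat.le_add_right _ _).trans (hsum _))
    · exact hlen _ ((Nat.le_add_left _ _).trans (hsum _))
    · exact h0
    · exact h0

theorem isPolyTimeApproximation_main : IsPolyTimeApproximation 2 IsSquareSquare main := by
  let W := main.weight
  let P : Polynomial ℕ := .C initProg.weight +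
    (.X * (.C searchInit.weight + ((.X * .C (searchStep.weight + 1) + 1) + .C finish.weight) + 1) +
      1 + 4)
  have hP : ∀ n, P.eval n = stepBound n := fun n => by
    simp [P, stepBound]
  -- This is the bound `N * (W * (R + 1))` of `Steps.exec` with `N = P` and `R = X + P * W`,
  -- evaluated at the input size.
  refine ⟨P * (.C W * (.X + P * .C W + 1)), fun I hI hQ => ?_⟩
  obtain ⟨s, N, hsteps, hN, hsol⟩ := main_runs hI hQ
  have hN' : N ≤ stepBound I.size := by
    refine hN.trans ?_
    have := n_le_size I
    unfold stepBound
    gcongr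
  obtain ⟨-, t, hexec, ht⟩ := hsteps.exec (W := W) le_rfl (input_bits I)
    (R := I.size + stepBound I.size * W) (by gcongr)
  refine ⟨s, t, hexec, ht.trans ?_, hsol⟩
  simp only [Polynomial.eval_mul, Polynomial.eval_add, Polynomial.eval_C, Polynomial.eval_X,
    Polynomial.eval_one, hP]
  gcongr

end Program

end DemandInstance

theorem mainTheorem4 :
    ∃ p : RAM.Prog, IsPolyTimeApproximation 2 DemandInstance.IsSquareSquare p :=
  ⟨_, DemandInstance.Program.isPolyTimeApproximation_main⟩
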